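/- Let $s \ge 2$ be an integer. For a prime $p$ put $A = (\mathbb{Z}/p)[x_1,\dots,x_s]$ and $h = \sum_{i=1}^s x_i^2 \in A$. For $n \ge 0$ let $q = p^n$ and let $e_n = e_n(h)$ be the colength (the length of the quotient $A$-module $A/I$) of the ideal $I = (h, x_1^q, \dots, x_s^q)$ of $A$. Then every $e_n$ is finite, and there is a (unique) real number $\mu = \mu_p$, the Hilbert-Kunz multiplicity of $h$, such that $e_n = \mu q^{s-1} + O(q^{s-2})$ as $n \to \infty$ with $p$ fixed. As $p \to \infty$ through the primes, $$\mu_p \longrightarrow 1 + \bigl(\text{the coefficient of } z^{s-1} \text{ in the power series expansion of } \sec z + \tan z \text{ at } z=0\bigr).$$ -/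

import Mathlib

open Filter Topology Asymptotics MvPolynomial

/-- The ideal of `(ℤ/p)[x₁, …, x_s]` generated by `h` and the powers `x_i ^ (p ^ n)`. -/
noncomputable def frobeniusIdeal {s p : ℕ} (h : MvPolynomial (Fin s) (ZMod p)) (n : ℕ) :
    Ideal (MvPolynomial (Fin s) (ZMod p)) :=
  Ideal.span (insert h (Set.range fun i : Fin s => (X i : MvPolynomial (Fin s) (ZMod p)) ^ p ^ n))

/-- `m` is the Hilbert-Kunz multiplicity of `h` (for `s ≥ 2` and `p` prime): writing `e n` for the
colength of the ideal generated by `h` and the `x_i ^ q`, where `q = p ^ n`, the colengths `e n` are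
finite and `e n = m * q ^ (s - 1) + O(q ^ (s - 2))` as `n → ∞`. -/
def IsHilbertKunzMultiplicity {s p : ℕ} (h : MvPolynomial (Fin s) (ZMod p)) (m : ℝ) : Prop :=
  ∃ e : ℕ → ℕ,
    (∀ n, Module.length (MvPolynomial (Fin s) (ZMod p))
      (MvPolynomial (Fin s) (ZMod p) ⧸ frobeniusIdeal h n) = e n) ∧
    (fun n => (e n : ℝ) - m * ((p : ℝ) ^ n) ^ (s - 1)) =O[atTop]
      fun n => ((p : ℝ) ^ n) ^ (s - 2)

/-- There is at most one Hilbert-Kunz multiplicity. -/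
theorem IsHilbertKunzMultiplicity.unique {s p : ℕ} (hs : 2 ≤ s) (hp : p.Prime)
    {h : MvPolynomial (Fin s) (ZMod p)} {m m' : ℝ}
    (hm : IsHilbertKunzMultiplicity h m) (hm' : IsHilbertKunzMultiplicity h m') : m = m' := by
  obtain ⟨e, he, hO⟩ := hm
  obtain ⟨e', he', hO'⟩ := hm'
  obtain rfl : e = e' := funext fun n => by
    have := (he n).symm.trans (he' n)
    exact_mod_cast this
  have hp1 : (1 : ℝ) < p := by exact_mod_cast hp.one_lt
  have hq : Tendsto (fun n : ℕ => (p : ℝ) ^ n) atTop atTop := tendsto_pow_atTop_atTop_of_one_lt hp1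
  have hlit : (fun n : ℕ => ((p : ℝ) ^ n) ^ (s - 2)) =o[atTop]
      fun n : ℕ => ((p : ℝ) ^ n) ^ (s - 1) :=
    (isLittleO_pow_pow_atTop_of_lt (𝕜 := ℝ) (show s - 2 < s - 1 by omega)).comp_tendsto hq
  have h1 : (fun n : ℕ => (m' - m) * ((p : ℝ) ^ n) ^ (s - 1)) =o[atTop]
      fun n : ℕ => ((p : ℝ) ^ n) ^ (s - 1) := by
    refine ((hO.sub hO').trans_isLittleO hlit).congr_left fun n => ?_
    ring
  by_contra hne
  have hc : m' - m ≠ 0 := sub_ne_zero.mpr (Ne.symm hne)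
  rw [isLittleO_const_mul_left_iff hc] at h1
  have h2 := isLittleO_irrefl' (l := (atTop : Filter ℕ))
    (f' := fun n : ℕ => ((p : ℝ) ^ n) ^ (s - 1)) (Frequently.of_forall fun n =>
      norm_ne_zero_iff.mpr (by positivity))
  exact h2 h1

/-- The coefficient of `z ^ n` in the power series (Taylor) expansion of `sec z + tan z` at `0`. -/
noncomputable def secTanCoeff (n : ℕ) : ℝ :=
  iteratedDeriv n (fun z : ℝ => (Real.cos z)⁻¹ + Real.tan z) 0 / (n.factorial : ℝ)

/-!
The substitution `xᵢ ↦ xᵢ²` multiplies colengths by `2 ^ s` and turns `∑ xᵢ` into `∑ xᵢ²`, so up to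
rounding `q / 2` the colength `e_n` is `2 ^ s` times that of `(∑ xᵢ, x₁^m, …, x_s^m)` for
`m = q / 2`. The Frobenius endomorphism multiplies the latter by `p ^ (s - 1)` when `m` is replaced
by `p m`, and replacing `m` by `m + t` changes it by `O(t (m + t) ^ (s - 2))`. Hence `μ_p` exists
and is within `O(1 / p)` of the value read off from `m = p / 2`.

For `m ≤ p` this colength has a closed form. Let `d(a, c)` be the colength of
`(x₁^a₁, …, x_s^a_s, (∑ xᵢ)^c)`. The automorphism `f ↦ f + ε ∂f/∂xᵢ` of the ring of dual numbers
over the polynomial ring shows that `d` satisfies the discrete wave equation in `aᵢ` and `c`, and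
the solution is a mean of products of the Chebyshev polynomials `sin (b θ) / sin θ` over the angles
`θ = j π / p`. As `p → ∞` the term of index `j`, scaled, tends to `sinc (j π / 2) ^ s`, so that by
dominated convergence `μ_p` tends to `∑_j sinc (j π / 2) ^ s`.

The terms with `j` even add up to `1`. Those with `j` odd are, up to pairing `j` with `-j`, powers
of the inverses of the poles of `sec z + tan z`, whose Taylor coefficients are found from the
partial fractions of its derivative `1 / (1 - sin z)`, that is, of `π² / sin²`.
-/

section Colength

variable {k : Type*} [CommRing k]

theorem mem_sup_span_singleton_iff {A : Type*} [CommRing A] {I : Ideal A} {u x : A} :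
    x ∈ I ⊔ Ideal.span {u} ↔ ∃ a, x - a * u ∈ I := by
  rw [sup_comm, Ideal.mem_span_singleton_sup]
  exact exists_congr fun a => ⟨fun ⟨b, hb, h⟩ => by rwa [← h, add_sub_cancel_left],
    fun h => ⟨_, h, add_sub_cancel _ _⟩⟩

theorem length_le_add_of_exact {M N P : Type*} [AddCommGroup M] [AddCommGroup N] [AddCommGroup P]
    [Module k M] [Module k N] [Module k P] (f : N →ₗ[k] M) (g : M →ₗ[k] P)
    (hg : Function.Surjective g) (hfg : Function.Exact f g) :
    Module.length k M ≤ Module.length k N + Module.length k P := by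
  have hrange : Function.Exact f.range.subtype g := by
    rw [LinearMap.exact_iff, Submodule.range_subtype, ← LinearMap.exact_iff]
    exact hfg
  rw [Module.length_eq_add_of_exact _ g (Submodule.subtype_injective _) hg hrange]
  gcongr
  exact Module.length_le_of_surjective f.rangeRestrict f.surjective_rangeRestrict

/-- The colength of an ideal of a `k`-algebra, measured over `k` rather than over the algebra. -/
noncomputable def colength (k : Type*) [CommRing k] {A : Type*} [CommRing A] [Algebra k A]
    (I : Ideal A) : ℕ∞ :=
  Module.length k (A ⧸ I)

variable {A : Type*} [CommRing A] [Algebra k A]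

theorem colength_anti {I J : Ideal A} (h : I ≤ J) : colength k J ≤ colength k I :=
  Module.length_le_of_surjective (Ideal.Quotient.factorₐ k h).toLinearMap
    (Ideal.Quotient.factor_surjective h)

theorem colength_top : colength k (⊤ : Ideal A) = 0 :=
  have : Subsingleton (A ⧸ (⊤ : Ideal A)) := Ideal.Quotient.subsingleton_iff.mpr rfl
  Module.length_eq_zero

theorem colength_eq_length_of_surjective {V : Type*} [AddCommGroup V] [Module k V] {I : Ideal A}
    (f : A →ₗ[k] V) (hf : Function.Surjective f) (hker : ∀ x, f x = 0 ↔ x ∈ I) :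
    colength k I = Module.length k V := by
  have hI : LinearMap.ker f = I.restrictScalars k := Submodule.ext hker
  have e := f.quotKerEquivOfSurjective hf
  rw [hI] at e
  exact e.length_eq

theorem colength_comap_of_surjective {B : Type*} [CommRing B] [Algebra k B] (f : A →ₐ[k] B)
    (hf : Function.Surjective f) (J : Ideal B) : colength k (J.comap f) = colength k J :=
  colength_eq_length_of_surjective ((Ideal.Quotient.mkₐ k J).toLinearMap ∘ₗ f.toLinearMap)
    (Ideal.Quotient.mk_surjective.comp hf) fun _ => Ideal.Quotient.eq_zero_iff_mem

theorem colength_map_algEquiv {B : Type*} [CommRing B] [Algebra k B] (e : A ≃ₐ[k] B)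
    (I : Ideal A) : colength k (I.map e) = colength k I := by
  have h : (I.map e).comap e.toAlgHom = I := Ideal.comap_map_of_bijective e e.bijective
  rw [← colength_comap_of_surjective e.toAlgHom e.surjective, h]

/-- Multiplication by `u` gives an exact sequence `A ⧸ (I, v) → A ⧸ (I, u v) → A ⧸ (I, u) → 0`. -/
theorem colength_sup_span_mul_le (I : Ideal A) (u v : A) :
    colength k (I ⊔ Ideal.span {u * v}) ≤
      colength k (I ⊔ Ideal.span {u}) + colength k (I ⊔ Ideal.span {v}) := by
  have huv : I ⊔ Ideal.span {u * v} ≤ I ⊔ Ideal.span {u} :=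
    sup_le_sup_left (Ideal.span_singleton_le_span_singleton.mpr (Dvd.intro _ rfl)) _
  have hmul : I ⊔ Ideal.span {v} ≤
      Submodule.comap (LinearMap.mulLeft A u) (I ⊔ Ideal.span {u * v}) := by
    intro x hx
    obtain ⟨a, ha⟩ := mem_sup_span_singleton_iff.mp hx
    refine mem_sup_span_singleton_iff.mpr ⟨a, ?_⟩
    convert I.mul_mem_left u ha using 1
    rw [LinearMap.mulLeft_apply]
    ring
  rw [add_comm]
  refine length_le_add_of_exact ((Submodule.mapQ _ _ _ hmul).restrictScalars k)
    (Ideal.Quotient.factorₐ k huv).toLinearMap (Ideal.Quotient.factor_surjective huv) fun x => ?_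
  obtain ⟨x, rfl⟩ := Ideal.Quotient.mk_surjective x
  refine (Ideal.Quotient.eq_zero_iff_mem.trans mem_sup_span_singleton_iff).trans
    ⟨fun ⟨a, ha⟩ => ⟨Ideal.Quotient.mk _ a, ?_⟩, ?_⟩
  · refine (Ideal.Quotient.mk_eq_mk_iff_sub_mem _ _).mpr (Ideal.mem_sup_left ?_)
    rw [← neg_mem_iff, neg_sub, LinearMap.mulLeft_apply, mul_comm]
    exact ha
  · rintro ⟨a, ha⟩
    obtain ⟨a, rfl⟩ := Ideal.Quotient.mk_surjective a
    have h := (Ideal.Quotient.mk_eq_mk_iff_sub_mem _ _).mp ha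
    obtain ⟨b, hb⟩ := mem_sup_span_singleton_iff.mp h
    refine ⟨a - b * v, ?_⟩
    rw [← neg_mem_iff]
    convert hb using 1
    rw [LinearMap.mulLeft_apply]
    ring

theorem colength_sup_span_pow_add_le (I : Ideal A) (u : A) (a t : ℕ) :
    colength k (I ⊔ Ideal.span {u ^ (a + t)}) ≤
      colength k (I ⊔ Ideal.span {u ^ a}) + t * colength k (I ⊔ Ideal.span {u}) := by
  induction t with
  | zero => simp
  | succ t ih =>
    rw [← add_assoc, pow_succ, Nat.cast_succ, add_one_mul, ← add_assoc]
    exact (colength_sup_span_mul_le _ _ _).trans (by gcongr)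

end Colength

section LengthOverResidueRing

variable {k A : Type*} [CommRing k] [CommRing A] [Algebra k A] {I : Ideal A}

theorem length_eq_length_of_smul_eq_zero (hI : ∀ a : A, ∃ c : k, a - algebraMap k A c ∈ I)
    {M : Type*} [AddCommGroup M] [Module k M] [Module A M] [IsScalarTower k A M]
    (h : ∀ a ∈ I, ∀ x : M, a • x = 0) : Module.length A M = Module.length k M := by
  refine le_antisymm ?_ ?_
  · rw [← WithBot.coe_le_coe, Module.coe_length, Module.coe_length]
    exact Order.krullDim_le_of_orderEmbedding (Submodule.restrictScalarsEmbedding k A M)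
  · have smul_mem : ∀ (N : Submodule k M) (a : A) {x : M}, x ∈ N → a • x ∈ N := fun N a x hx => by
      obtain ⟨c, hc⟩ := hI a
      have hac := h _ hc x
      rw [sub_smul, sub_eq_zero, algebraMap_smul] at hac
      exact hac ▸ N.smul_mem c hx
    rw [← WithBot.coe_le_coe, Module.coe_length, Module.coe_length]
    exact Order.krullDim_le_of_strictMono
      (fun N : Submodule k M => ({ N with smul_mem' := smul_mem N } : Submodule A M)) fun _ _ h => h

theorem length_eq_length_of_pow_smul_eq_zero (hI : ∀ a : A, ∃ c : k, a - algebraMap k A c ∈ I)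
    (n : ℕ) {M : Type*} [AddCommGroup M] [Module k M] [Module A M] [IsScalarTower k A M]
    (h : ∀ a ∈ I ^ n, ∀ x : M, a • x = 0) : Module.length A M = Module.length k M := by
  induction n generalizing M with
  | zero =>
    have : Subsingleton M := subsingleton_of_forall_eq 0 fun x => by
      rw [← one_smul A x, h 1 (by simp)]
    simp
  | succ n ih =>
    let S : Submodule A M := I • ⊤
    have hS : Module.length A S = Module.length k S := by
      refine ih fun a ha ⟨x, hx⟩ => Subtype.ext ?_
      have : I ^ n • S ≤ ⊥ := by
        rw [← Submodule.mul_smul, ← pow_succ]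
        exact Submodule.smul_le.mpr fun a ha x _ => (Submodule.mem_bot A).mpr (h a ha x)
      exact (Submodule.mem_bot A).mp (this (Submodule.smul_mem_smul ha hx))
    have hquot : Module.length A (M ⧸ S) = Module.length k (M ⧸ S) := by
      refine length_eq_length_of_smul_eq_zero hI fun a ha x => ?_
      obtain ⟨x, rfl⟩ := S.mkQ_surjective x
      exact (Submodule.Quotient.mk_eq_zero S).mpr (Submodule.smul_mem_smul ha trivial)
    rw [Module.length_eq_add_of_exact S.subtype S.mkQ S.subtype_injective S.mkQ_surjective
      (LinearMap.exact_subtype_mkQ S), hS, hquot]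
    exact (Module.length_eq_add_of_exact (S.subtype.restrictScalars k) (S.mkQ.restrictScalars k)
      S.subtype_injective S.mkQ_surjective (LinearMap.exact_subtype_mkQ S)).symm

theorem length_quotient_eq_colength (hI : ∀ a : A, ∃ c : k, a - algebraMap k A c ∈ I) {n : ℕ}
    {J : Ideal A} (h : I ^ n ≤ J) : Module.length A (A ⧸ J) = colength k J :=
  length_eq_length_of_pow_smul_eq_zero hI n fun a ha x => by
    obtain ⟨x, rfl⟩ := Ideal.Quotient.mk_surjective x
    exact Ideal.Quotient.eq_zero_iff_mem.mpr (J.mul_mem_right x (h ha))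

theorem sub_C_constantCoeff_mem_idealOfVars {σ : Type*} (f : MvPolynomial σ k) :
    f - algebraMap k _ (constantCoeff f) ∈ idealOfVars σ k := by
  rw [← pow_one (idealOfVars σ k), mem_pow_idealOfVars_iff']
  intro m hm
  obtain rfl : m = 0 := (Finsupp.degree_eq_zero_iff m).mp (Nat.lt_one_iff.mp hm)
  simp [algebraMap_eq, constantCoeff_eq]

end LengthOverResidueRing

section WaveEquation

open scoped DualNumber
open TrivSqZeroExt

variable {k A : Type*} [CommRing k] [CommRing A] [Algebra k A]

/-- The automorphism `f ↦ f + ε D f` of the ring of dual numbers `A[ε]` attached to a derivation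
`D` of `A`. -/
noncomputable def dualNumberShift (D : Derivation k A A) : A[ε] ≃ₐ[k] A[ε] where
  toFun z := z + inr (D z.fst)
  invFun z := z - inr (D z.fst)
  left_inv z := by ext <;> simp
  right_inv z := by ext <;> simp
  map_add' z w := by
    ext
    · simp
    · simp [add_add_add_comm]
  map_mul' z w := by
    ext
    · simp
    · simp only [fst_mul, snd_add, snd_inr, snd_mul, Derivation.leibniz, smul_eq_mul,
        MulOpposite.smul_eq_mul_unop, MulOpposite.unop_op, fst_add, fst_inr, add_zero]
      ring
  commutes' c := by simp [algebraMap_eq_inl']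

theorem mem_map_inlHom_iff {I : Ideal A} {z : A[ε]} :
    z ∈ I.map (inlHom A A) ↔ z.fst ∈ I ∧ z.snd ∈ I := by
  refine ⟨fun hz => ?_, fun ⟨h1, h2⟩ => ?_⟩
  · induction hz using Submodule.span_induction with
    | mem x hx =>
      obtain ⟨a, ha, rfl⟩ := hx
      simpa using ha
    | zero => simp
    | add x y _ _ hx hy => exact ⟨I.add_mem hx.1 hy.1, I.add_mem hx.2 hy.2⟩
    | smul a x _ hx =>
      exact ⟨I.mul_mem_left _ hx.1, I.add_mem (I.mul_mem_left _ hx.2) (I.mul_mem_left _ hx.1)⟩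
  · have : z = inlHom A A z.fst + DualNumber.eps * inlHom A A z.snd := by ext <;> simp
    rw [this]
    exact add_mem (Ideal.mem_map_of_mem _ h1) (Ideal.mul_mem_left _ _ (Ideal.mem_map_of_mem _ h2))

theorem mem_map_inlHom_sup_span_singleton_iff {I : Ideal A} {w z : A[ε]} :
    z ∈ I.map (inlHom A A) ⊔ Ideal.span {w} ↔
      ∃ a b, z.fst - a * w.fst ∈ I ∧ z.snd - (a * w.snd + b * w.fst) ∈ I := by
  simp only [mem_sup_span_singleton_iff, mem_map_inlHom_iff]
  refine ⟨fun ⟨a, h⟩ => ⟨a.fst, a.snd, ?_⟩, fun ⟨a, b, h⟩ => ⟨inl a + inr b, ?_⟩⟩ <;>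
    simpa using h

theorem map_dualNumberShift_map_inlHom {D : Derivation k A A} {I : Ideal A}
    (hD : ∀ f ∈ I, D f ∈ I) :
    (I.map (inlHom A A)).map (dualNumberShift D) = I.map (inlHom A A) := by
  ext z
  rw [Ideal.mem_map_of_equiv]
  constructor
  · rintro ⟨z, hz, rfl⟩
    rw [mem_map_inlHom_iff] at hz ⊢
    simpa [dualNumberShift] using ⟨hz.1, add_mem hz.2 (hD _ hz.1)⟩
  · intro hz
    refine ⟨(dualNumberShift D).symm z, ?_, (dualNumberShift D).apply_symm_apply z⟩
    rw [mem_map_inlHom_iff] at hz ⊢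
    simpa [dualNumberShift] using ⟨hz.1, sub_mem hz.2 (hD _ hz.1)⟩

theorem colength_eq_add_of_surjective {I : Ideal A[ε]} {J₁ J₂ : Ideal A} (φ : A[ε] →ₗ[k] A × A)
    (hφ : Function.Surjective φ) (h : ∀ z, z ∈ I ↔ (φ z).1 ∈ J₁ ∧ (φ z).2 ∈ J₂) :
    colength k I = colength k J₁ + colength k J₂ := by
  have hmk := Function.Surjective.prodMap (Ideal.Quotient.mk_surjective (I := J₁))
    (Ideal.Quotient.mk_surjective (I := J₂))
  refine (colength_eq_length_of_surjective
    ((Ideal.Quotient.mkₐ k J₁).toLinearMap.prodMap (Ideal.Quotient.mkₐ k J₂).toLinearMap ∘ₗ φ)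
    (hmk.comp hφ) fun z => ?_).trans (Module.length_prod ..)
  rw [h, Prod.ext_iff]
  exact and_congr Ideal.Quotient.eq_zero_iff_mem Ideal.Quotient.eq_zero_iff_mem

theorem colength_map_inlHom (I : Ideal A) :
    colength k (I.map (inlHom A A)) = 2 * colength k I := by
  rw [two_mul]
  exact colength_eq_add_of_surjective LinearMap.id Function.surjective_id
    fun z => mem_map_inlHom_iff

theorem pow_sub_mem_and_iff {I : Ideal A} {y g u v : A} (hg : IsUnit g) (c : ℕ) :
    (∃ a b, u - a * y ^ (c + 1) ∈ I ∧ v - (a * (g * y ^ c) + b * y ^ (c + 1)) ∈ I) ↔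
      g * u - y * v ∈ I ⊔ Ideal.span {y ^ (c + 2)} ∧ v ∈ I ⊔ Ideal.span {y ^ c} := by
  obtain ⟨g', hg'⟩ := hg.exists_right_inv
  simp only [mem_sup_span_singleton_iff]
  constructor
  · rintro ⟨a, b, hu, hv⟩
    refine ⟨⟨-b, ?_⟩, a * g + b * y, ?_⟩
    · convert I.sub_mem (I.mul_mem_left g hu) (I.mul_mem_left y hv) using 1
      ring
    · convert hv using 1
      ring
  · rintro ⟨⟨b, hu⟩, a, hv⟩
    refine ⟨g' * (a + b * y), -b, ?_, ?_⟩
    · convert I.mul_mem_left g' (I.add_mem hu (I.mul_mem_left y hv)) using 1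
      linear_combination (-u) * hg'
    · convert hv using 1
      linear_combination (-y ^ c * (a + b * y)) * hg'

theorem colength_map_inlHom_sup_span (I : Ideal A) (y : A) {γ : A} (c : ℕ)
    (hγ : IsUnit (γ * ((c + 1 : ℕ) : A))) :
    colength k (I.map (inlHom A A) ⊔ Ideal.span {(inl y + inr γ) ^ (c + 1)}) =
      colength k (I ⊔ Ideal.span {y ^ (c + 2)}) + colength k (I ⊔ Ideal.span {y ^ c}) := by
  obtain ⟨g, hg⟩ : ∃ g, g = γ * ((c + 1 : ℕ) : A) := ⟨_, rfl⟩
  rw [← hg] at hγ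
  obtain ⟨g', hg'⟩ := hγ.exists_right_inv
  let fst : A[ε] →ₗ[k] A := (fstHom k A A).toLinearMap
  let snd : A[ε] →ₗ[k] A := (sndHom A A).restrictScalars k
  refine colength_eq_add_of_surjective ((g • fst - y • snd).prod snd) ?_ fun z => ?_
  · rintro ⟨u, v⟩
    refine ⟨inl (g' * (u + y * v)) + inr v, Prod.ext ?_ ?_⟩
    · suffices g * (g' * (u + y * v)) - y * v = u by simpa [fst, snd]
      linear_combination (u + y * v) * hg'
    · simp [snd]
  · have hfst : ((inl y + inr γ : A[ε]) ^ (c + 1)).fst = y ^ (c + 1) := by simp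
    have hsnd : ((inl y + inr γ : A[ε]) ^ (c + 1)).snd = g * y ^ c := by
      suffices ((c : A) + 1) * (y ^ c * γ) = γ * (c + 1) * y ^ c by simpa [hg]
      ring
    rw [mem_map_inlHom_sup_span_singleton_iff, hfst, hsnd]
    exact pow_sub_mem_and_iff hγ c

theorem map_dualNumberShift {I : Ideal A} {D : Derivation k A A} (hD : ∀ f ∈ I, D f ∈ I)
    {x y : A} (hx : D x = 1) (hy : D y = 1) (b c : ℕ) :
    ((I ⊔ Ideal.span {x ^ b}).map (inlHom A A) ⊔
        Ideal.span {(inl y + inr (-1)) ^ c}).map (dualNumberShift D) =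
      (I ⊔ Ideal.span {y ^ c}).map (inlHom A A) ⊔ Ideal.span {(inl x + inr 1) ^ b} := by
  have hshift_x : dualNumberShift D (inlHom A A x) = inl x + inr 1 := by simp [dualNumberShift, hx]
  have hshift_y : dualNumberShift D (inl y + inr (-1)) = inlHom A A y := by
    simp [dualNumberShift, hy, add_assoc]
  simp only [Ideal.map_sup, map_dualNumberShift_map_inlHom hD, Ideal.map_span,
    Set.image_singleton, map_pow, hshift_x, hshift_y]
  exact sup_right_comm (I.map (inlHom A A)) _ _

/-- The dual number shift moves the perturbation by `ε` from `y` to `x`, so both sides compute the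
colength of the ideal `(I, x ^ (b + 1), (y - ε) ^ (c + 1))` of `A[ε]`. -/
theorem colength_wave {I : Ideal A} {D : Derivation k A A} (hD : ∀ f ∈ I, D f ∈ I)
    {x y : A} (hx : D x = 1) (hy : D y = 1) {b c : ℕ} (hb : IsUnit ((b + 1 : ℕ) : k))
    (hc : IsUnit ((c + 1 : ℕ) : k)) :
    colength k (I ⊔ Ideal.span {x ^ (b + 2)} ⊔ Ideal.span {y ^ (c + 1)}) +
      colength k (I ⊔ Ideal.span {x ^ b} ⊔ Ideal.span {y ^ (c + 1)}) =
    colength k (I ⊔ Ideal.span {x ^ (b + 1)} ⊔ Ideal.span {y ^ (c + 2)}) +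
      colength k (I ⊔ Ideal.span {x ^ (b + 1)} ⊔ Ideal.span {y ^ c}) := by
  have hb' : IsUnit (1 * ((b + 1 : ℕ) : A)) := by simpa using hb.map (algebraMap k A)
  have hc' : IsUnit (-1 * ((c + 1 : ℕ) : A)) := by simpa using (hc.map (algebraMap k A)).neg
  rw [sup_right_comm I _ (Ideal.span {y ^ (c + 1)}), sup_right_comm I _ (Ideal.span {y ^ (c + 1)}),
    ← colength_map_inlHom_sup_span _ x b hb', ← map_dualNumberShift hD hx hy,
    colength_map_algEquiv, colength_map_inlHom_sup_span _ y c hc']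

theorem colength_wave_boundary {I : Ideal A} {D : Derivation k A A} (hD : ∀ f ∈ I, D f ∈ I)
    {x y : A} (hx : D x = 1) (hy : D y = 1) {b c : ℕ} (hb : IsUnit ((b + 1 : ℕ) : k))
    (hc : (c : k) = 0) :
    colength k (I ⊔ Ideal.span {x ^ (b + 2)} ⊔ Ideal.span {y ^ c}) +
      colength k (I ⊔ Ideal.span {x ^ b} ⊔ Ideal.span {y ^ c}) =
    2 * colength k (I ⊔ Ideal.span {x ^ (b + 1)} ⊔ Ideal.span {y ^ c}) := by
  have hb' : IsUnit (1 * ((b + 1 : ℕ) : A)) := by simpa using hb.map (algebraMap k A)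
  have hcA : (c : A) = 0 := by simpa using congrArg (algebraMap k A) hc
  have hpow : (inl y + inr (-1) : A[ε]) ^ c = inlHom A A (y ^ c) := by
    ext <;> simp [hcA]
  have hspan : Ideal.span {(inl y + inr (-1) : A[ε]) ^ c} =
      (Ideal.span {y ^ c}).map (inlHom A A) := by
    rw [hpow, Ideal.map_span, Set.image_singleton]
  rw [sup_right_comm I _ (Ideal.span {y ^ c}), sup_right_comm I _ (Ideal.span {y ^ c}),
    ← colength_map_inlHom_sup_span _ x b hb', ← map_dualNumberShift hD hx hy,
    colength_map_algEquiv, hspan, ← Ideal.map_sup, colength_map_inlHom]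

end WaveEquation

section MonomialIdeals

variable {k : Type*} [CommRing k] {σ : Type*}

/-- The ideal of `k[x_i]` generated by the powers `x_i ^ a_i`. -/
noncomputable def powIdeal (k : Type*) [CommRing k] {σ : Type*} (a : σ → ℕ) :
    Ideal (MvPolynomial σ k) :=
  Ideal.span (Set.range fun i => X i ^ a i)

/-- The sum of the variables. -/
noncomputable def sumX (k : Type*) [CommRing k] (σ : Type*) [Fintype σ] : MvPolynomial σ k :=
  ∑ i, X i

theorem X_pow_mem_powIdeal (a : σ → ℕ) (i : σ) : (X i ^ a i : MvPolynomial σ k) ∈ powIdeal k a :=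
  Ideal.subset_span ⟨i, rfl⟩

theorem powIdeal_le_iff {a : σ → ℕ} {I : Ideal (MvPolynomial σ k)} :
    powIdeal k a ≤ I ↔ ∀ i, (X i ^ a i : MvPolynomial σ k) ∈ I := by
  rw [powIdeal, Ideal.span_le, Set.range_subset_iff]
  rfl

theorem powIdeal_anti {a b : σ → ℕ} (h : a ≤ b) : powIdeal k b ≤ powIdeal k a :=
  powIdeal_le_iff.mpr fun i => Ideal.mem_of_dvd _ (pow_dvd_pow _ (h i)) (X_pow_mem_powIdeal a i)

theorem map_expand_powIdeal (m : ℕ) (a : σ → ℕ) :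
    (powIdeal k a).map (expand m) = powIdeal k fun i => m * a i := by
  simp only [powIdeal, Ideal.map_span, ← Set.range_comp, Function.comp_def, map_pow, expand_X,
    pow_mul]

section Expand

variable [Fintype σ] {m : ℕ}

/-- The exponent vector with entries `ε i < m`: the monomials with these exponents form a basis
of `k[x_i]` over its subring `k[x_i ^ m]`. -/
noncomputable def smallExponent (ε : σ → Fin m) : σ →₀ ℕ :=
  Finsupp.equivFunOnFinite.symm fun i => (ε i : ℕ)

theorem smul_add_smallExponent_inj (hm : 0 < m) {ε ε' : σ → Fin m} {n n' : σ →₀ ℕ} :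
    m • n + smallExponent ε = m • n' + smallExponent ε' ↔ n = n' ∧ ε = ε' := by
  refine ⟨fun h => ?_, fun ⟨hn, hε⟩ => hn ▸ hε ▸ rfl⟩
  have hi (i : σ) : m * n i + ε i = m * n' i + ε' i := DFunLike.congr_fun h i
  refine ⟨Finsupp.ext fun i => ?_, funext fun i => Fin.ext ?_⟩
  · simpa [Nat.mul_add_div hm, Nat.div_eq_of_lt (Fin.is_lt _)] using congrArg (· / m) (hi i)
  · simpa [Nat.mul_add_mod, Nat.mod_eq_of_lt (Fin.is_lt _)] using congrArg (· % m) (hi i)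

theorem exists_eq_smul_add_smallExponent (hm : 0 < m) (d : σ →₀ ℕ) :
    ∃ (n : σ →₀ ℕ) (ε : σ → Fin m), d = m • n + smallExponent ε :=
  ⟨Finsupp.equivFunOnFinite.symm fun i => d i / m, fun i => ⟨d i % m, Nat.mod_lt _ hm⟩,
    Finsupp.ext fun i => (Nat.div_add_mod (d i) m).symm⟩

theorem coeff_monomial_smallExponent_mul_expand (hm : 0 < m) (ε ε' : σ → Fin m) (n : σ →₀ ℕ)
    (g : MvPolynomial σ k) :
    coeff (m • n + smallExponent ε) (monomial (smallExponent ε') 1 * expand m g) =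
      if ε' = ε then coeff n g else 0 := by
  classical
  induction g using MvPolynomial.induction_on' with
  | monomial n' c =>
    rw [expand_monomial, monomial_mul, one_mul, coeff_monomial, coeff_monomial, ← ite_and,
      add_comm]
    exact if_congr ((smul_add_smallExponent_inj hm).trans and_comm) rfl rfl
  | add p q hp hq =>
    rw [map_add, mul_add, coeff_add, hp, hq, coeff_add]
    split_ifs <;> simp

section ExpandSum

variable [DecidableEq σ]

/-- The map `(f_ε) ↦ ∑ x ^ ε f_ε(x ^ m)`, where `0 ≤ ε_i < m`. -/
noncomputable def expandSum (k : Type*) [CommRing k] (σ : Type*) [Fintype σ] [DecidableEq σ]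
    (m : ℕ) : ((σ → Fin m) → MvPolynomial σ k) →ₗ[k] MvPolynomial σ k :=
  ∑ ε : σ → Fin m, LinearMap.mulLeft k (monomial (smallExponent ε) 1) ∘ₗ
    (expand m).toLinearMap ∘ₗ LinearMap.proj ε

theorem expandSum_apply (f : (σ → Fin m) → MvPolynomial σ k) :
    expandSum k σ m f = ∑ ε, monomial (smallExponent ε) 1 * expand m (f ε) := by
  simp [expandSum]

theorem coeff_expandSum (hm : 0 < m) (f : (σ → Fin m) → MvPolynomial σ k) (ε : σ → Fin m)
    (n : σ →₀ ℕ) :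
    coeff (m • n + smallExponent ε) (expandSum k σ m f) = coeff n (f ε) := by
  simp only [expandSum_apply, coeff_sum, coeff_monomial_smallExponent_mul_expand hm,
    Finset.sum_ite_eq', Finset.mem_univ, if_true]

theorem expandSum_injective (hm : 0 < m) : Function.Injective (expandSum k σ m) := by
  intro f g h
  funext ε
  ext n
  rw [← coeff_expandSum hm, ← coeff_expandSum hm, h]

theorem expandSum_surjective (hm : 0 < m) : Function.Surjective (expandSum k σ m) := by
  intro f
  induction f using MvPolynomial.induction_on' with
  | monomial d c =>
    obtain ⟨n, ε, rfl⟩ := exists_eq_smul_add_smallExponent hm d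
    refine ⟨Pi.single ε (monomial n c), ?_⟩
    rw [expandSum_apply, Finset.sum_eq_single ε (fun ε' _ h => by simp [Pi.single_eq_of_ne h])
      (by simp), Pi.single_eq_same, expand_monomial, monomial_mul, one_mul, add_comm]
  | add p q hp hq =>
    obtain ⟨f, rfl⟩ := hp
    obtain ⟨g, rfl⟩ := hq
    exact ⟨f + g, map_add _ _ _⟩

theorem expandSum_mul_expand (f : (σ → Fin m) → MvPolynomial σ k) (g : MvPolynomial σ k) :
    expandSum k σ m f * expand m g = expandSum k σ m fun ε => f ε * g := by
  simp only [expandSum_apply, Finset.sum_mul, map_mul, mul_assoc]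

theorem expandSum_mem_map_iff (hm : 0 < m) (I : Ideal (MvPolynomial σ k))
    (f : (σ → Fin m) → MvPolynomial σ k) :
    expandSum k σ m f ∈ I.map (expand m) ↔ ∀ ε, f ε ∈ I := by
  constructor
  · suffices H : ∀ x ∈ I.map (expand m), ∃ g, expandSum k σ m g = x ∧ ∀ ε, g ε ∈ I by
      intro h
      obtain ⟨g, hg, hgI⟩ := H _ h
      rwa [← expandSum_injective hm hg]
    intro x hx
    induction hx using Submodule.closure_induction with
    | zero => exact ⟨0, map_zero _, fun _ => I.zero_mem⟩
    | add _ _ _ _ hx hy =>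
      obtain ⟨f, rfl, hf⟩ := hx
      obtain ⟨g, rfl, hg⟩ := hy
      exact ⟨f + g, map_add _ _ _, fun ε => I.add_mem (hf ε) (hg ε)⟩
    | smul_mem a x hx =>
      obtain ⟨i, hi, rfl⟩ := hx
      obtain ⟨f, rfl⟩ := expandSum_surjective hm a
      exact ⟨fun ε => f ε * i, (expandSum_mul_expand f i).symm, fun ε => I.mul_mem_left _ hi⟩
  · intro h
    rw [expandSum_apply]
    exact Ideal.sum_mem _ fun ε _ => Ideal.mul_mem_left _ _ (Ideal.mem_map_of_mem _ (h ε))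

end ExpandSum

theorem colength_map_expand (hm : 0 < m) (I : Ideal (MvPolynomial σ k)) :
    colength k (I.map (expand m)) = m ^ Fintype.card σ * colength k I := by
  classical
  let e := LinearEquiv.ofBijective (expandSum k σ m)
    ⟨expandSum_injective hm, expandSum_surjective hm⟩
  rw [colength_eq_length_of_surjective
    ((Ideal.Quotient.mkₐ k I).toLinearMap.compLeft (σ → Fin m) ∘ₗ e.symm.toLinearMap)
    (Ideal.Quotient.mk_surjective.comp_left.comp e.symm.surjective), Module.length_pi]
  · simp [colength]
  · intro x
    obtain ⟨f, rfl⟩ := e.surjective x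
    refine Iff.trans ?_ (expandSum_mem_map_iff hm I f).symm
    simp [funext_iff, Ideal.Quotient.eq_zero_iff_mem]

end Expand

section Elimination

/-- The `k`-algebra map `k[x_0, …, x_r] → k[x_1, …, x_r]` that sends `x_0` to `-∑ x_i`. -/
noncomputable def elimHom (k : Type*) [CommRing k] (r : ℕ) :
    MvPolynomial (Fin (r + 1)) k →ₐ[k] MvPolynomial (Fin r) k :=
  aeval (Fin.cons (-sumX k (Fin r)) X)

@[simp]
theorem elimHom_X_zero (r : ℕ) : elimHom k r (X 0) = -sumX k (Fin r) := by simp [elimHom]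

@[simp]
theorem elimHom_X_succ (r : ℕ) (i : Fin r) : elimHom k r (X i.succ) = X i := by simp [elimHom]

theorem elimHom_sumX (r : ℕ) : elimHom k r (sumX k _) = 0 := by
  simp [sumX, Fin.sum_univ_succ]

theorem elimHom_rename_succ (r : ℕ) (f : MvPolynomial (Fin r) k) :
    elimHom k r (rename Fin.succ f) = f := by
  have : (elimHom k r).comp (rename Fin.succ) = AlgHom.id k _ := by
    ext i
    simp
  exact DFunLike.congr_fun this f

theorem elimHom_surjective (r : ℕ) : Function.Surjective (elimHom k r) :=
  fun f => ⟨rename Fin.succ f, elimHom_rename_succ r f⟩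

theorem comap_elimHom_bot_le (r : ℕ) :
    Ideal.comap (elimHom k r) ⊥ ≤ Ideal.span {sumX k (Fin (r + 1))} := by
  intro f hf
  have hcomp : (Ideal.Quotient.mkₐ k (Ideal.span {sumX k (Fin (r + 1))})).comp
      ((rename Fin.succ).comp (elimHom k r)) = Ideal.Quotient.mkₐ k _ := by
    ext i
    refine Fin.cases ?_ (fun i => ?_) i
    · simp only [AlgHom.comp_apply, elimHom_X_zero, Ideal.Quotient.mkₐ_eq_mk]
      rw [Ideal.Quotient.mk_eq_mk_iff_sub_mem, ← Ideal.neg_mem_iff]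
      convert Ideal.mem_span_singleton_self (sumX k (Fin (r + 1))) using 1
      simp [sumX, Fin.sum_univ_succ]
    · simp
  have hf0 : elimHom k r f = 0 := hf
  have h := DFunLike.congr_fun hcomp f
  rw [AlgHom.comp_apply, AlgHom.comp_apply, hf0, map_zero, map_zero] at h
  exact Ideal.Quotient.eq_zero_iff_mem.mp h.symm

theorem map_elimHom_powIdeal_sup_sumX {r : ℕ} (c : ℕ) (a : Fin r → ℕ) :
    (powIdeal k (Fin.cons c a) ⊔ Ideal.span {sumX k (Fin (r + 1))}).map (elimHom k r) =
      powIdeal k a ⊔ Ideal.span {sumX k (Fin r) ^ c} := by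
  have hspan : Ideal.span {(-sumX k (Fin r)) ^ c} = Ideal.span {sumX k (Fin r) ^ c} := by
    rw [neg_pow]
    exact Ideal.span_singleton_mul_left_unit (isUnit_one.neg.pow c) _
  have hrange : (Set.range fun i => (X i ^ (Fin.cons c a : Fin (r + 1) → ℕ) i :
      MvPolynomial (Fin (r + 1)) k)) = insert (X 0 ^ c) (Set.range fun i => X i.succ ^ a i) := by
    ext f
    simp [Fin.exists_fin_succ, eq_comm]
  rw [Ideal.map_sup, Ideal.map_span, Set.image_singleton, elimHom_sumX, Ideal.span_singleton_zero,
    sup_bot_eq, powIdeal, Ideal.map_span, hrange, Set.image_insert_eq, Ideal.span_insert, map_pow,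
    elimHom_X_zero, hspan, sup_comm, powIdeal, ← Set.range_comp]
  simp [Function.comp_def]

theorem colength_powIdeal_cons_sup_sumX {r : ℕ} (c : ℕ) (a : Fin r → ℕ) :
    colength k (powIdeal k (Fin.cons c a) ⊔ Ideal.span {sumX k (Fin (r + 1))}) =
      colength k (powIdeal k a ⊔ Ideal.span {sumX k (Fin r) ^ c}) := by
  rw [← map_elimHom_powIdeal_sup_sumX, ← colength_comap_of_surjective _ (elimHom_surjective r),
    Ideal.comap_map_of_surjective _ (elimHom_surjective r),
    sup_eq_left.mpr ((comap_elimHom_bot_le r).trans le_sup_right)]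

end Elimination

end MonomialIdeals

section Bounds

variable {k : Type*} [Field k] {σ : Type*}

theorem powIdeal_eq_top {a : σ → ℕ} {i : σ} (h : a i = 0) : powIdeal k a = ⊤ := by
  rw [Ideal.eq_top_iff_one]
  simpa [h] using X_pow_mem_powIdeal (k := k) a i

theorem colength_powIdeal_one : colength k (powIdeal k fun _ : σ => 1) = 1 := by
  have hker (f : MvPolynomial σ k) : constantCoeff f = 0 ↔ f ∈ powIdeal k fun _ : σ => 1 := by
    have hI : powIdeal k (fun _ : σ => 1) = idealOfVars σ k ^ 1 := by
      simp only [powIdeal, idealOfVars, pow_one]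
    rw [hI, mem_pow_idealOfVars_iff', constantCoeff_eq]
    simp only [Nat.lt_one_iff, Finsupp.degree_eq_zero_iff, forall_eq]
  rw [colength_eq_length_of_surjective (aeval fun _ : σ => (0 : k)).toLinearMap
    (fun c => ⟨C c, by simp⟩) fun f => by simpa [aeval_zero'] using hker f,
    Module.length_eq_one_iff]
  infer_instance

/-- The ideal generated by the powers `x_j ^ a_j` with `j ≠ i`. -/
noncomputable def powIdealErase (k : Type*) [Field k] {σ : Type*} (a : σ → ℕ) (i : σ) :
    Ideal (MvPolynomial σ k) :=
  Ideal.span ((fun j => X j ^ a j) '' {i}ᶜ)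

theorem powIdeal_update [DecidableEq σ] (a : σ → ℕ) (i : σ) (b : ℕ) :
    powIdeal k (Function.update a i b) = powIdealErase k a i ⊔ Ideal.span {X i ^ b} := by
  have himage : (fun j => (X j : MvPolynomial σ k) ^ Function.update a i b j) '' {i}ᶜ =
      (fun j => X j ^ a j) '' {i}ᶜ :=
    Set.image_congr fun j hj => by rw [Function.update_of_ne hj]
  rw [powIdeal, powIdealErase, ← Ideal.span_union, ← Set.image_univ, ← Set.compl_union_self {i},
    Set.image_union, himage, Set.image_singleton, Function.update_self]

theorem colength_powIdeal_update_add_le [DecidableEq σ] (a : σ → ℕ) (i : σ) (b t : ℕ)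
    (J : Ideal (MvPolynomial σ k)) :
    colength k (powIdeal k (Function.update a i (b + t)) ⊔ J) ≤
      colength k (powIdeal k (Function.update a i b) ⊔ J) +
        t * colength k (powIdeal k (Function.update a i 1) ⊔ J) := by
  simp only [powIdeal_update, pow_one, sup_right_comm _ _ J]
  exact colength_sup_span_pow_add_le _ _ _ _

theorem colength_powIdeal_le_mul_update_one [DecidableEq σ] (a : σ → ℕ) (i : σ) :
    colength k (powIdeal k a) ≤ a i * colength k (powIdeal k (Function.update a i 1)) := by
  have h := colength_powIdeal_update_add_le (k := k) a i 0 (a i) ⊥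
  rwa [zero_add, Function.update_eq_self, powIdeal_eq_top (Function.update_self i 0 a), top_sup_eq,
    colength_top, zero_add, sup_bot_eq, sup_bot_eq] at h

variable [Fintype σ]

theorem colength_powIdeal_le (a : σ → ℕ) : colength k (powIdeal k a) ≤ (∏ i, a i : ℕ) := by
  suffices H : ∀ (S : Finset σ) (a : σ → ℕ), (∀ i ∉ S, a i = 1) →
      colength k (powIdeal k a) ≤ (∏ i ∈ S, a i : ℕ) from H _ a (by simp)
  classical
  intro S
  induction S using Finset.induction_on with
  | empty =>
    intro a ha
    obtain rfl : a = fun _ => 1 := funext fun i => ha i (Finset.notMem_empty i)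
    simp [colength_powIdeal_one]
  | insert i S hi ih =>
    intro a ha
    have hupdate : ∀ j ∉ S, Function.update a i 1 j = 1 := fun j hj => by
      rcases eq_or_ne j i with rfl | hji
      · exact Function.update_self ..
      · rw [Function.update_of_ne hji, ha j (by simp [hji, hj])]
    have hprod : ∏ j ∈ S, Function.update a i 1 j = ∏ j ∈ S, a j :=
      Finset.prod_update_of_notMem hi _ _
    rw [Finset.prod_insert hi, Nat.cast_mul, ← hprod]
    exact (colength_powIdeal_le_mul_update_one a i).trans (by gcongr; exact ih _ hupdate)

theorem colength_powIdeal_sup_le (a : σ → ℕ) (J : Ideal (MvPolynomial σ k)) :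
    colength k (powIdeal k a ⊔ J) ≤ (∏ i, a i : ℕ) :=
  (colength_anti le_sup_left).trans (colength_powIdeal_le a)

theorem colength_powIdeal_sup_ne_top {σ : Type*} [Finite σ] (a : σ → ℕ)
    (J : Ideal (MvPolynomial σ k)) : colength k (powIdeal k a ⊔ J) ≠ ⊤ :=
  have := Fintype.ofFinite σ
  ne_top_of_le_ne_top (ENat.natCast_ne_top _) (colength_powIdeal_sup_le a J)

theorem colength_powIdeal_sup_le_add [DecidableEq σ] {a b : σ → ℕ} (hab : a ≤ b)
    (J : Ideal (MvPolynomial σ k)) :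
    colength k (powIdeal k b ⊔ J) ≤ colength k (powIdeal k a ⊔ J) +
      (∑ i, (b i - a i) * ∏ j ∈ Finset.univ.erase i, b j : ℕ) := by
  suffices H : ∀ S : Finset σ, colength k (powIdeal k (S.piecewise b a) ⊔ J) ≤
      colength k (powIdeal k a ⊔ J) +
        (∑ i ∈ S, (b i - a i) * ∏ j ∈ Finset.univ.erase i, b j : ℕ) by
    simpa using H Finset.univ
  intro S
  induction S using Finset.induction_on with
  | empty => simp
  | insert i S hi ih =>
    have hone : colength k (powIdeal k (Function.update (S.piecewise b a) i 1) ⊔ J) ≤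
        (∏ j ∈ Finset.univ.erase i, b j : ℕ) := by
      refine (colength_powIdeal_sup_le _ J).trans (Nat.cast_le.mpr ?_)
      rw [Finset.prod_update_of_mem (Finset.mem_univ i), one_mul, Finset.sdiff_singleton_eq_erase]
      exact Finset.prod_le_prod' fun j _ => S.piecewise_le_of_le_of_le le_rfl hab j
    have hstep := colength_powIdeal_update_add_le (S.piecewise b a) i (a i) (b i - a i) J
    have hself : Function.update (S.piecewise b a) i (a i) = S.piecewise b a := by
      rw [← S.piecewise_eq_of_notMem b a hi, Function.update_eq_self]
    rw [Nat.add_sub_cancel' (hab i), hself, ← Finset.piecewise_insert] at hstep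
    rw [Finset.sum_insert hi, add_comm (_ * _), Nat.cast_add, ← add_assoc, Nat.cast_mul]
    exact hstep.trans (by gcongr)

end Bounds

section SumIdeal

variable {k : Type*} [Field k]

/-- The dimension of `k[x_i] / (x_i ^ a_i, (∑ x_i) ^ c)`. -/
noncomputable def powDim (k : Type*) [Field k] {σ : Type*} [Fintype σ] (a : σ → ℕ) (c : ℕ) : ℕ :=
  (colength k (powIdeal k a ⊔ Ideal.span {sumX k σ ^ c})).toNat

/-- The dimension of `k[x_1, …, x_s] / (x_1 ^ m, …, x_s ^ m, x_1 + ⋯ + x_s)`, for `s = r + 2`. -/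
noncomputable def sumDim (k : Type*) [Field k] (r m : ℕ) : ℕ :=
  powDim k (fun _ : Fin (r + 2) => m) 1

theorem coe_powDim {σ : Type*} [Fintype σ] (a : σ → ℕ) (c : ℕ) :
    (powDim k a c : ℕ∞) = colength k (powIdeal k a ⊔ Ideal.span {sumX k σ ^ c}) :=
  ENat.natCast_toNat (colength_powIdeal_sup_ne_top _ _)

theorem coe_sumDim (r m : ℕ) : (sumDim k r m : ℕ∞) =
    colength k (powIdeal k (fun _ : Fin (r + 2) => m) ⊔ Ideal.span {sumX k (Fin (r + 2))}) := by
  rw [sumDim, coe_powDim, pow_one]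

theorem powDim_one_eq_powDim (r m : ℕ) :
    powDim k (fun _ : Fin (r + 1) => m) 1 = powDim k (fun _ : Fin r => m) m := by
  have hcons : (fun _ : Fin (r + 1) => m) = Fin.cons m fun _ => m := (Fin.cons_self_tail _).symm
  rw [powDim, powDim, pow_one, hcons, colength_powIdeal_cons_sup_sumX]

theorem sumDim_eq_powDim (r m : ℕ) : sumDim k r m = powDim k (fun _ : Fin (r + 1) => m) m :=
  powDim_one_eq_powDim (r + 1) m

theorem sumDim_mono (r : ℕ) : Monotone (sumDim k r) := by
  intro m m' h
  rw [← Nat.cast_le (α := ℕ∞), coe_sumDim, coe_sumDim]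
  exact colength_anti (sup_le_sup_right (powIdeal_anti fun _ => h) _)

theorem sumDim_add_le (r m t : ℕ) :
    sumDim k r (m + t) ≤ sumDim k r m + (r + 2) * t * (m + t) ^ r := by
  have hpow := colength_sup_span_pow_add_le (k := k) (powIdeal k fun _ : Fin (r + 1) => m + t)
    (sumX k (Fin (r + 1))) m t
  have hbase := colength_powIdeal_sup_le_add (k := k) (a := fun _ : Fin (r + 1) => m)
    (b := fun _ => m + t) (fun _ => Nat.le_add_right m t) (Ideal.span {sumX k (Fin (r + 1)) ^ m})
  have hlin : colength k (powIdeal k (fun _ : Fin (r + 1) => m + t) ⊔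
      Ideal.span {sumX k (Fin (r + 1))}) ≤ ((m + t) ^ r : ℕ) := by
    rw [← pow_one (sumX k _), ← coe_powDim, powDim_one_eq_powDim, coe_powDim]
    simpa using colength_powIdeal_sup_le (k := k) (fun _ : Fin r => m + t) _
  simp only [Nat.add_sub_cancel_left, Finset.prod_const, Finset.sum_const, Finset.card_univ,
    Finset.card_erase_of_mem (Finset.mem_univ _), Fintype.card_fin, Nat.add_sub_cancel,
    smul_eq_mul] at hbase
  rw [← Nat.cast_le (α := ℕ∞), sumDim_eq_powDim, sumDim_eq_powDim, Nat.cast_add]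
  simp only [coe_powDim]
  refine hpow.trans ((add_le_add hbase (mul_le_mul_right hlin _)).trans_eq ?_)
  rw [add_assoc]
  congr 1
  norm_cast
  ring

theorem sumDim_mul_char (p : ℕ) [hp : Fact p.Prime] [CharP k p] (r m : ℕ) :
    sumDim k r (p * m) = p ^ (r + 1) * sumDim k r m := by
  have hexpand : expand p (sumX k (Fin (r + 1))) = sumX k (Fin (r + 1)) ^ p := by
    simp [sumX, sum_pow_char]
  have h := colength_map_expand (k := k) hp.out.pos
    (powIdeal k (fun _ : Fin (r + 1) => m) ⊔ Ideal.span {sumX k (Fin (r + 1)) ^ m})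
  rw [Ideal.map_sup, map_expand_powIdeal, Ideal.map_span, Set.image_singleton, map_pow, hexpand,
    ← pow_mul, ← coe_powDim, ← coe_powDim, ← sumDim_eq_powDim, ← sumDim_eq_powDim,
    Fintype.card_fin] at h
  exact_mod_cast h

theorem colength_powIdeal_two_mul_sup_sum_sq (r m : ℕ) :
    colength k (powIdeal k (fun _ : Fin (r + 2) => 2 * m) ⊔
      Ideal.span {∑ i : Fin (r + 2), (X i : MvPolynomial (Fin (r + 2)) k) ^ 2}) =
      (2 ^ (r + 2) * sumDim k r m : ℕ) := by
  have hexpand : expand 2 (sumX k (Fin (r + 2))) = ∑ i, X i ^ 2 := by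
    simp [sumX]
  rw [← map_expand_powIdeal, ← hexpand, ← Set.image_singleton, ← Ideal.map_span, ← Ideal.map_sup,
    colength_map_expand two_pos, ← coe_sumDim, Fintype.card_fin]
  push_cast
  rfl

end SumIdeal

section Frobenius

variable {p : ℕ} [Fact p.Prime]

theorem length_quotient_frobeniusIdeal {s : ℕ} (h : MvPolynomial (Fin s) (ZMod p)) (n : ℕ) :
    Module.length (MvPolynomial (Fin s) (ZMod p))
      (MvPolynomial (Fin s) (ZMod p) ⧸ frobeniusIdeal h n) =
      colength (ZMod p) (powIdeal (ZMod p) (fun _ => p ^ n) ⊔ Ideal.span {h}) := by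
  have heq : frobeniusIdeal h n = powIdeal (ZMod p) (fun _ => p ^ n) ⊔ Ideal.span {h} := by
    rw [frobeniusIdeal, Ideal.span_insert, sup_comm]
    rfl
  have hrad : idealOfVars (Fin s) (ZMod p) ≤ (frobeniusIdeal h n).radical := by
    rw [idealOfVars, Ideal.span_le, heq]
    rintro _ ⟨i, rfl⟩
    exact ⟨p ^ n, Ideal.mem_sup_left (X_pow_mem_powIdeal (fun _ => p ^ n) i)⟩
  obtain ⟨N, hN⟩ := Ideal.exists_pow_le_of_le_radical_of_fg hrad (idealOfVars_fg _ _)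
  rw [length_quotient_eq_colength (fun f => ⟨_, sub_C_constantCoeff_mem_idealOfVars f⟩) hN, heq]

/-- Substituting `x_i ^ 2` for `x_i` computes the colength when `p ^ n` is replaced by an even
number, and `p ^ n` lies between two consecutive even numbers. -/
theorem exists_length_frobeniusIdeal_sum_sq (r n : ℕ) :
    ∃ e : ℕ, Module.length (MvPolynomial (Fin (r + 2)) (ZMod p))
      (MvPolynomial (Fin (r + 2)) (ZMod p) ⧸
        frobeniusIdeal (∑ i, (X i : MvPolynomial (Fin (r + 2)) (ZMod p)) ^ 2) n) = e ∧
      2 ^ (r + 2) * sumDim (ZMod p) r (p ^ n / 2) ≤ e ∧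
      e ≤ 2 ^ (r + 2) * sumDim (ZMod p) r (p ^ n / 2 + 1) := by
  obtain ⟨e, he⟩ := ENat.ne_top_iff_exists.mp (colength_powIdeal_sup_ne_top (k := ZMod p)
    (fun _ => p ^ n) (Ideal.span {∑ i : Fin (r + 2), X i ^ 2}))
  rw [length_quotient_frobeniusIdeal]
  refine ⟨e, he.symm, ?_, ?_⟩ <;>
    rw [← Nat.cast_le (α := ℕ∞), he, ← colength_powIdeal_two_mul_sup_sum_sq] <;>
    refine colength_anti (sup_le_sup_right (powIdeal_anti fun _ => ?_) _)
  · exact Nat.mul_div_le (p ^ n) 2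
  · exact (Nat.lt_mul_div_succ (p ^ n) two_pos).le

end Frobenius

section ChebyshevMean

open Polynomial.Chebyshev

/-- The Chebyshev polynomial of the second kind, with the index shifted so that
`sinPoly b (cos θ) * sin θ = sin (b θ)`. -/
noncomputable def sinPoly (b : ℕ) : Polynomial ℝ := U ℝ ((b : ℤ) - 1)

@[simp]
theorem sinPoly_zero : sinPoly 0 = 0 := by simp [sinPoly]

@[simp]
theorem sinPoly_one : sinPoly 1 = 1 := by simp [sinPoly]

theorem sinPoly_add_two (b : ℕ) :
    sinPoly (b + 2) = 2 * Polynomial.X * sinPoly (b + 1) - sinPoly b := by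
  have h := U_add_two ℝ ((b : ℤ) - 1)
  rw [sub_add_cancel, sub_add_eq_add_sub] at h
  simp [sinPoly, h]

theorem sinPoly_add_two_eq_T (b : ℕ) :
    sinPoly (b + 2) = 2 * T ℝ (b + 1 : ℕ) + sinPoly b := by
  have h := U_eq_two_mul_T_add_U ℝ ((b : ℤ) - 1)
  rw [sub_add_eq_add_sub] at h
  rw [sinPoly, sinPoly, Nat.cast_add, Nat.cast_ofNat, h, add_sub_assoc]
  norm_num

theorem eval_sinPoly_cos_mul_sin (b : ℕ) (θ : ℝ) :
    (sinPoly b).eval (Real.cos θ) * Real.sin θ = Real.sin (b * θ) := by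
  rw [sinPoly, U_real_cos]
  simp

/-- The mean over the angles `θ = j π / p` of `(1 + cos θ) f (cos θ)`. The Chebyshev polynomials
`sinPoly c` with `0 < c ≤ p` all have mean `1`. -/
noncomputable def chebMean (p : ℕ) : Polynomial ℝ →ₗ[ℝ] ℝ :=
  ∑ j ∈ Finset.Ico (-p : ℤ) p,
    ((1 + Real.cos (j * Real.pi / p)) / (2 * p)) • Polynomial.leval (Real.cos (j * Real.pi / p))

theorem chebMean_apply (p : ℕ) (f : Polynomial ℝ) :
    chebMean p f = ∑ j ∈ Finset.Ico (-p : ℤ) p,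
      (1 + Real.cos (j * Real.pi / p)) / (2 * p) * f.eval (Real.cos (j * Real.pi / p)) := by
  simp [chebMean, Polynomial.leval]

theorem card_Ico_neg (p : ℕ) : (Finset.Ico (-p : ℤ) p).card = 2 * p := by
  rw [Int.card_Ico]
  omega

theorem sum_Ico_neg_cos_mul_two_sin (p : ℕ) (x : ℝ) :
    (∑ j ∈ Finset.Ico (-p : ℤ) p, Real.cos (j * x)) * (2 * Real.sin (x / 2)) =
      2 * Real.sin (p * x) * Real.cos (x / 2) := by
  have hterm (i : ℕ) : Real.cos ((-p + i : ℝ) * x) * (2 * Real.sin (x / 2)) =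
      Real.sin ((-p + (i + 1 : ℕ) : ℝ) * x - x / 2) - Real.sin ((-p + i : ℝ) * x - x / 2) := by
    have hadd : (-p + (i + 1 : ℕ) : ℝ) * x - x / 2 = (-p + i : ℝ) * x + x / 2 := by
      push_cast
      ring
    rw [hadd, Real.sin_add, Real.sin_sub]
    ring
  have hreindex : ∑ j ∈ Finset.Ico (-p : ℤ) p, Real.cos (j * x) =
      ∑ i ∈ Finset.range (2 * p), Real.cos ((-p + i : ℝ) * x) := by
    rw [Int.Ico_eq_finset_map, Finset.sum_map, sub_neg_eq_add, ← two_mul]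
    norm_cast
  rw [hreindex, Finset.sum_mul, Finset.sum_congr rfl fun i _ => hterm i,
    Finset.sum_range_sub fun i : ℕ => Real.sin ((-p + i : ℝ) * x - x / 2)]
  have hlast : (-p + (2 * p : ℕ) : ℝ) * x - x / 2 = p * x - x / 2 := by
    push_cast
    ring
  have hfirst : (-p + (0 : ℕ) : ℝ) * x - x / 2 = -(p * x + x / 2) := by
    push_cast
    ring
  rw [hlast, hfirst, Real.sin_neg, Real.sin_add, Real.sin_sub]
  ring

theorem sum_cos_mul_pi_div {p m : ℕ} (hm : 0 < m) (hmp : m < 2 * p) :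
    ∑ j ∈ Finset.Ico (-p : ℤ) p, Real.cos (m * (j * Real.pi / p)) = 0 := by
  have hp : (0 : ℝ) < p := by
    have : 0 < p := by omega
    exact_mod_cast this
  have hsin : 0 < Real.sin (m * Real.pi / p / 2) := by
    refine Real.sin_pos_of_pos_of_lt_pi (by positivity) ?_
    rw [div_div, div_lt_iff₀ (by positivity), mul_comm]
    gcongr
    rw [mul_comm]
    exact_mod_cast hmp
  have h := sum_Ico_neg_cos_mul_two_sin p (m * Real.pi / p)
  rw [mul_div_cancel₀ _ hp.ne', Real.sin_nat_mul_pi, mul_zero, zero_mul] at h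
  rw [← (mul_eq_zero.mp h).resolve_right (by positivity)]
  exact Finset.sum_congr rfl fun j _ => by ring_nf

theorem chebMean_T {p m : ℕ} (hmp : m + 2 < 2 * p) :
    chebMean p (T ℝ (m + 1 : ℕ)) =
      (∑ j ∈ Finset.Ico (-p : ℤ) p, Real.cos (m * (j * Real.pi / p))) / (4 * p) := by
  have hterm (θ : ℝ) : (1 + Real.cos θ) * Real.cos ((m + 1 : ℕ) * θ) =
      Real.cos ((m + 1 : ℕ) * θ) +
        (Real.cos ((m + 2 : ℕ) * θ) + Real.cos (m * θ)) / 2 := by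
    have hadd : ((m + 2 : ℕ) : ℝ) * θ = (m + 1 : ℕ) * θ + θ := by push_cast; ring
    have hsub : (m : ℝ) * θ = (m + 1 : ℕ) * θ - θ := by push_cast; ring
    rw [hadd, hsub, Real.cos_add, Real.cos_sub]
    ring
  rw [chebMean_apply]
  simp only [T_real_cos, Int.cast_natCast, div_mul_eq_mul_div, hterm]
  rw [← Finset.sum_div, Finset.sum_add_distrib, ← Finset.sum_div, Finset.sum_add_distrib,
    sum_cos_mul_pi_div m.succ_pos (by omega), sum_cos_mul_pi_div (by omega : 0 < m + 2) hmp]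
  ring

theorem chebMean_one {p : ℕ} (hp : p ≠ 0) : chebMean p 1 = 1 := by
  have hcos := sum_cos_mul_pi_div one_pos (by omega : 1 < 2 * p)
  simp only [Nat.cast_one, one_mul] at hcos
  simp only [chebMean_apply, Polynomial.eval_one, mul_one]
  rw [← Finset.sum_div, Finset.sum_add_distrib, hcos]
  have hp' : (p : ℝ) ≠ 0 := Nat.cast_ne_zero.mpr hp
  simp only [Finset.sum_const, card_Ico_neg, nsmul_eq_mul, mul_one, add_zero]
  push_cast
  field_simp

theorem chebMean_sinPoly {p c : ℕ} (hc : c + 1 ≤ p) : chebMean p (sinPoly (c + 1)) = 1 := by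
  induction c using Nat.twoStepInduction with
  | zero => rw [zero_add, sinPoly_one, chebMean_one (by omega)]
  | one =>
    have hp' : (p : ℝ) ≠ 0 := Nat.cast_ne_zero.mpr (by omega)
    rw [sinPoly_add_two_eq_T 0, sinPoly_zero, add_zero, two_mul, map_add, chebMean_T (by omega)]
    simp only [Nat.cast_zero, zero_mul, Real.cos_zero, Finset.sum_const, card_Ico_neg,
      nsmul_eq_mul, mul_one]
    push_cast
    field_simp
    norm_num
  | more c ih _ =>
    rw [sinPoly_add_two_eq_T, two_mul, map_add, map_add, chebMean_T (by omega),
      sum_cos_mul_pi_div c.succ_pos (by omega), ih (by omega)]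
    simp

theorem chebMean_boundary {p : ℕ} (hp : p ≠ 0) (f : Polynomial ℝ) :
    chebMean p ((Polynomial.X - 1) * sinPoly p * f) = 0 := by
  rw [chebMean_apply]
  refine Finset.sum_eq_zero fun j _ => ?_
  have hsin : (sinPoly p).eval (Real.cos (j * Real.pi / p)) * Real.sin (j * Real.pi / p) = 0 := by
    rw [eval_sinPoly_cos_mul_sin, mul_div_cancel₀ _ (Nat.cast_ne_zero.mpr hp), Real.sin_int_mul_pi]
  simp only [Polynomial.eval_mul, Polynomial.eval_sub, Polynomial.eval_X, Polynomial.eval_one]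
  generalize (j : ℝ) * Real.pi / p = θ at hsin ⊢
  linear_combination (f.eval (Real.cos θ) / (2 * p)) * (-Real.sin θ * hsin +
    (sinPoly p).eval (Real.cos θ) * Real.sin_sq_add_cos_sq θ)

end ChebyshevMean

section TrigonometricFormula

theorem eq_zero_of_discrete_wave {R : Type*} [AddCommGroup R] {p : ℕ} {W : ℕ → ℕ → R}
    (hzero : ∀ c ≤ p, W 0 c = 0) (hone : ∀ c ≤ p, W 1 c = 0) (hleft : ∀ b ≤ p, W b 0 = 0)
    (hwave : ∀ b c, b + 1 < p → c + 1 < p →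
      W (b + 2) (c + 1) + W b (c + 1) = W (b + 1) (c + 2) + W (b + 1) c)
    (hright : ∀ b, b + 1 < p → W (b + 2) p + W b p = 2 • W (b + 1) p) :
    ∀ b ≤ p, ∀ c ≤ p, W b c = 0 := by
  intro b
  induction b using Nat.twoStepInduction with
  | zero => exact fun _ => hzero
  | one => exact fun _ => hone
  | more b ih ih' =>
    intro hb c hc
    rcases c with _ | c
    · exact hleft _ hb
    rcases hc.lt_or_eq with hc' | rfl
    · have h := hwave b c hb hc'
      rwa [ih (by omega) _ hc, ih' (by omega) _ hc', ih' (by omega) _ (by omega), add_zero,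
        add_zero] at h
    · have h := hright b hb
      rwa [ih (by omega) _ hc, ih' (by omega) _ hc, smul_zero, add_zero] at h

variable {k : Type*} [Field k] {σ : Type*}

theorem pderiv_mem_powIdealErase (a : σ → ℕ) (i : σ) {f : MvPolynomial σ k}
    (hf : f ∈ powIdealErase k a i) : pderiv i f ∈ powIdealErase k a i := by
  induction hf using Submodule.span_induction with
  | mem x hx =>
    obtain ⟨j, hj, rfl⟩ := hx
    simp [Derivation.leibniz_pow, pderiv_X_of_ne (Set.mem_compl_singleton_iff.mp hj)]
  | zero => simp
  | add x y _ _ hx hy =>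
    rw [map_add]
    exact Ideal.add_mem _ hx hy
  | smul g x hx hDx =>
    rw [smul_eq_mul, Derivation.leibniz]
    exact Ideal.add_mem _ (Ideal.mul_mem_left _ _ hDx) (Ideal.mul_mem_right _ _ hx)

variable [Fintype σ]

theorem powDim_of_eq_zero {a : σ → ℕ} {i : σ} (h : a i = 0) (c : ℕ) : powDim k a c = 0 := by
  rw [powDim, powIdeal_eq_top h, top_sup_eq, colength_top, ENat.toNat_zero]

theorem powDim_zero (a : σ → ℕ) : powDim k a 0 = 0 := by
  rw [powDim, pow_zero, Ideal.span_singleton_one, sup_top_eq, colength_top, ENat.toNat_zero]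

theorem powDim_one (c : ℕ) : powDim k (fun _ : σ => 1) (c + 1) = 1 := by
  have h : Ideal.span {sumX k σ ^ (c + 1)} ≤ powIdeal k (fun _ : σ => 1) := by
    rw [Ideal.span_singleton_le_iff_mem, pow_succ]
    refine Ideal.mul_mem_left _ _ (Ideal.sum_mem _ fun i _ => ?_)
    simpa using X_pow_mem_powIdeal (k := k) (fun _ : σ => 1) i
  rw [powDim, sup_eq_left.mpr h, colength_powIdeal_one, ENat.toNat_one]

theorem pderiv_sumX (i : σ) : pderiv i (sumX k σ) = 1 := by
  classical simp [sumX, pderiv_X, Pi.single_apply]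

section Update

variable [DecidableEq σ]

theorem powDim_wave (a : σ → ℕ) (i : σ) {b c : ℕ} (hb : ((b + 1 : ℕ) : k) ≠ 0)
    (hc : ((c + 1 : ℕ) : k) ≠ 0) :
    powDim k (Function.update a i (b + 2)) (c + 1) + powDim k (Function.update a i b) (c + 1) =
      powDim k (Function.update a i (b + 1)) (c + 2) +
        powDim k (Function.update a i (b + 1)) c := by
  have h := colength_wave (fun _ => pderiv_mem_powIdealErase (k := k) a i) (pderiv_X_self i)
    (pderiv_sumX i) hb.isUnit hc.isUnit
  simp only [← powIdeal_update, ← coe_powDim] at h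
  exact_mod_cast h

theorem powDim_wave_boundary (a : σ → ℕ) (i : σ) {b c : ℕ} (hb : ((b + 1 : ℕ) : k) ≠ 0)
    (hc : (c : k) = 0) :
    powDim k (Function.update a i (b + 2)) c + powDim k (Function.update a i b) c =
      2 * powDim k (Function.update a i (b + 1)) c := by
  have h := colength_wave_boundary (fun _ => pderiv_mem_powIdealErase (k := k) a i)
    (pderiv_X_self i) (pderiv_sumX i) hb.isUnit hc
  simp only [← powIdeal_update, ← coe_powDim] at h
  exact_mod_cast h

theorem powDim_update_eq_chebMean {p : ℕ} [hp : Fact p.Prime] [CharP k p] {a : σ → ℕ} {i : σ}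
    {Q : Polynomial ℝ}
    (hone : ∀ c ≤ p, (powDim k (Function.update a i 1) c : ℝ) = chebMean p (Q * sinPoly c))
    {b c : ℕ} (hb : b ≤ p) (hc : c ≤ p) :
    (powDim k (Function.update a i b) c : ℝ) = chebMean p (Q * sinPoly b * sinPoly c) := by
  let W : ℕ → ℕ → ℝ := fun b c =>
    powDim k (Function.update a i b) c - chebMean p (Q * sinPoly b * sinPoly c)
  have hunit (b : ℕ) (hb : b + 1 < p) : ((b + 1 : ℕ) : k) ≠ 0 := by
    rw [Ne, CharP.cast_eq_zero_iff k p]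
    exact Nat.not_dvd_of_pos_of_lt b.succ_pos hb
  refine sub_eq_zero.mp (eq_zero_of_discrete_wave (W := W) (fun c _ => ?_) (fun c hc => ?_)
    (fun b _ => ?_) (fun b c hb hc => ?_) (fun b hb => ?_) b hb c hc)
  · simp [W, powDim_of_eq_zero (Function.update_self i 0 a)]
  · simp [W, hone c hc]
  · simp [W, powDim_zero]
  · have hdim : (powDim k (Function.update a i (b + 2)) (c + 1) : ℝ) +
        powDim k (Function.update a i b) (c + 1) =
        powDim k (Function.update a i (b + 1)) (c + 2) +
          powDim k (Function.update a i (b + 1)) c := by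
      exact_mod_cast powDim_wave a i (hunit b hb) (hunit c hc)
    have hmean : Q * sinPoly (b + 2) * sinPoly (c + 1) + Q * sinPoly b * sinPoly (c + 1) =
        Q * sinPoly (b + 1) * sinPoly (c + 2) + Q * sinPoly (b + 1) * sinPoly c := by
      rw [sinPoly_add_two, sinPoly_add_two]
      ring
    replace hmean := congrArg (chebMean p) hmean
    rw [map_add, map_add] at hmean
    linear_combination hdim - hmean
  · have hdim : (powDim k (Function.update a i (b + 2)) p : ℝ) +
        powDim k (Function.update a i b) p = 2 * powDim k (Function.update a i (b + 1)) p := by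
      exact_mod_cast powDim_wave_boundary a i (hunit b hb) (CharP.cast_eq_zero k p)
    have hmean : Q * sinPoly (b + 2) * sinPoly p + Q * sinPoly b * sinPoly p =
        2 • (Q * sinPoly (b + 1) * sinPoly p) +
          2 • ((Polynomial.X - 1) * sinPoly p * (Q * sinPoly (b + 1))) := by
      rw [sinPoly_add_two]
      ring
    replace hmean := congrArg (chebMean p) hmean
    rw [map_add, map_add, map_nsmul, map_nsmul, chebMean_boundary hp.out.ne_zero, smul_zero,
      add_zero, two_nsmul] at hmean
    rw [two_nsmul]
    linear_combination hdim - hmean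

end Update

theorem powDim_eq_chebMean {p : ℕ} [hp : Fact p.Prime] [CharP k p] {a : σ → ℕ} {c : ℕ}
    (ha : ∀ i, a i ≤ p) (hc : c ≤ p) :
    (powDim k a c : ℝ) = chebMean p ((∏ i, sinPoly (a i)) * sinPoly c) := by
  suffices H : ∀ (S : Finset σ) (a : σ → ℕ), (∀ i, a i ≤ p) → (∀ i ∉ S, a i = 1) → ∀ c ≤ p,
      (powDim k a c : ℝ) = chebMean p ((∏ i ∈ S, sinPoly (a i)) * sinPoly c) from
    H Finset.univ a ha (by simp) c hc
  classical
  intro S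
  induction S using Finset.induction_on with
  | empty =>
    intro a _ hone c hc
    obtain rfl : a = fun _ => 1 := funext fun i => hone i (Finset.notMem_empty i)
    rcases c with _ | c
    · simp [powDim_zero]
    · simp [powDim_one, chebMean_sinPoly hc]
  | insert i S hi ih =>
    intro a ha hone c hc
    have hprod : ∏ j ∈ S, sinPoly (Function.update a i 1 j) = ∏ j ∈ S, sinPoly (a j) :=
      Finset.prod_congr rfl fun j hj => by
        rw [Function.update_of_ne (ne_of_mem_of_not_mem hj hi)]
    have hupdate : ∀ c ≤ p, (powDim k (Function.update a i 1) c : ℝ) =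
        chebMean p ((∏ j ∈ S, sinPoly (a j)) * sinPoly c) := by
      refine hprod ▸ ih _ (fun j => ?_) fun j hj => ?_
      · rcases eq_or_ne j i with rfl | hji
        · simpa using hp.out.one_le
        · simpa [Function.update_of_ne hji] using ha j
      · rcases eq_or_ne j i with rfl | hji
        · exact Function.update_self ..
        · rw [Function.update_of_ne hji, hone j (by simp [hji, hj])]
    have h := powDim_update_eq_chebMean hupdate (ha i) hc
    rwa [Function.update_eq_self, mul_comm _ (sinPoly (a i)),
      ← Finset.prod_insert (f := fun j => sinPoly (a j)) hi] at h

theorem sumDim_eq_chebMean {p : ℕ} [hp : Fact p.Prime] [CharP k p] (r : ℕ) {m : ℕ} (hm : m ≤ p) :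
    (sumDim k r m : ℝ) = chebMean p (sinPoly m ^ (r + 2)) := by
  rw [sumDim, powDim_eq_chebMean (fun _ => hm) hp.out.one_le]
  simp

end TrigonometricFormula

section LimitOfTheMeans

open Real (sinc)

theorem eval_sinPoly_cos_mul_sinc (b : ℕ) (θ : ℝ) :
    (sinPoly b).eval (Real.cos θ) * sinc θ = b * sinc (b * θ) := by
  rcases eq_or_ne θ 0 with rfl | hθ
  · simp [sinPoly]
  rcases eq_or_ne b 0 with rfl | hb
  · simp
  have hb' : (b : ℝ) ≠ 0 := Nat.cast_ne_zero.mpr hb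
  rw [Real.sinc_of_ne_zero hθ, Real.sinc_of_ne_zero (mul_ne_zero hb' hθ), ← mul_div_assoc,
    eval_sinPoly_cos_mul_sin]
  field_simp

theorem abs_eval_sinPoly_cos_le (b : ℕ) (θ : ℝ) : |(sinPoly b).eval (Real.cos θ)| ≤ b := by
  induction b using Nat.twoStepInduction with
  | zero => simp
  | one => simp
  | more b ih _ =>
    have hcos := Real.abs_cos_le_one ((b + 1 : ℕ) * θ)
    have heval : (sinPoly (b + 2)).eval (Real.cos θ) =
        2 * Real.cos ((b + 1 : ℕ) * θ) + (sinPoly b).eval (Real.cos θ) := by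
      simp [sinPoly_add_two_eq_T, Polynomial.Chebyshev.T_real_cos]
    calc |(sinPoly (b + 2)).eval (Real.cos θ)|
        ≤ 2 * |Real.cos ((b + 1 : ℕ) * θ)| + |(sinPoly b).eval (Real.cos θ)| := by
          rw [heval, ← abs_two (α := ℝ), ← abs_mul, abs_two]
          exact abs_add_le _ _
      _ ≤ (b + 2 : ℕ) := by
          push_cast at hcos ⊢
          linarith

/-- Multiplying by `1 - cos θ` gives `sin² (b θ) ≤ 1`, and `1 - cos θ` is at least quadratic. -/
theorem one_add_cos_mul_sinPoly_sq_le (b : ℕ) {θ : ℝ} (hθ : θ ≠ 0) (hpi : |θ| ≤ Real.pi) :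
    (1 + Real.cos θ) * (sinPoly b).eval (Real.cos θ) ^ 2 ≤ Real.pi ^ 2 / (2 * θ ^ 2) := by
  set S := (sinPoly b).eval (Real.cos θ)
  have hsin : (1 + Real.cos θ) * S ^ 2 * (1 - Real.cos θ) ≤ 1 := by
    refine le_trans (le_of_eq ?_) (Real.sin_sq_le_one (b * θ))
    rw [← eval_sinPoly_cos_mul_sin, mul_pow, Real.sin_sq]
    ring
  have hcos : 2 * θ ^ 2 / Real.pi ^ 2 ≤ 1 - Real.cos θ := by
    rw [mul_div_right_comm]
    linarith [Real.cos_le_one_sub_mul_cos_sq hpi]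
  have hnonneg : 0 ≤ (1 + Real.cos θ) * S ^ 2 :=
    mul_nonneg (by linarith [Real.neg_one_le_cos θ]) (sq_nonneg S)
  rw [← one_div_div, le_div_iff₀ (by positivity)]
  exact (mul_le_mul_of_nonneg_left hcos hnonneg).trans hsin

/-- The contribution of the angle `θ = j π / p` to `chebMean p (sinPoly (p / 2) ^ s)`, multiplied
by `2 ^ s / p ^ (s - 1)`. -/
noncomputable def scaledTerm (s p : ℕ) (j : ℤ) : ℝ :=
  (1 + Real.cos (j * Real.pi / p)) / 2 *
    (2 / p * (sinPoly (p / 2)).eval (Real.cos (j * Real.pi / p))) ^ s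

theorem two_pow_mul_chebMean_div (r : ℕ) {p : ℕ} (hp : p ≠ 0) :
    2 ^ (r + 2) * chebMean p (sinPoly (p / 2) ^ (r + 2)) / (p : ℝ) ^ (r + 1) =
      ∑ j ∈ Finset.Ico (-p : ℤ) p, scaledTerm (r + 2) p j := by
  have hp' : (p : ℝ) ≠ 0 := Nat.cast_ne_zero.mpr hp
  rw [chebMean_apply, Finset.mul_sum, Finset.sum_div]
  refine Finset.sum_congr rfl fun j _ => ?_
  rw [scaledTerm, Polynomial.eval_pow, mul_pow, div_pow, pow_succ (p : ℝ) (r + 1)]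
  field_simp

theorem abs_two_div_mul_sinPoly_half_le_one (p : ℕ) (θ : ℝ) :
    |2 / p * (sinPoly (p / 2)).eval (Real.cos θ)| ≤ 1 := by
  calc |2 / p * (sinPoly (p / 2)).eval (Real.cos θ)| ≤ 2 / p * (p / 2) := by
        rw [abs_mul, abs_of_nonneg (by positivity : (0 : ℝ) ≤ 2 / p)]
        gcongr
        exact (abs_eval_sinPoly_cos_le _ _).trans Nat.cast_div_le
    _ = 2 * (p / p) / 2 := by ring
    _ ≤ 1 := by linarith [div_self_le_one (p : ℝ)]

theorem abs_scaledTerm_le (r : ℕ) {p : ℕ} {j : ℤ} (hj : j ∈ Finset.Ico (-p : ℤ) p) :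
    |scaledTerm (r + 2) p j| ≤ (Pi.single 0 1 : ℤ → ℝ) j + 1 / (j : ℝ) ^ 2 := by
  have hS := abs_two_div_mul_sinPoly_half_le_one p (j * Real.pi / p)
  have hcos : 0 ≤ (1 + Real.cos (j * Real.pi / p)) / 2 := by
    linarith [Real.neg_one_le_cos (j * Real.pi / p)]
  rw [scaledTerm, abs_mul, abs_pow, abs_of_nonneg hcos]
  rcases eq_or_ne j 0 with rfl | hj0
  · simpa using pow_le_one₀ (abs_nonneg _) hS
  have hj' : (j : ℝ) ≠ 0 := Int.cast_ne_zero.mpr hj0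
  rw [Finset.mem_Ico] at hj
  have hp : (0 : ℝ) < p := by
    have : 0 < p := by omega
    exact_mod_cast this
  have hpi : |j * Real.pi / p| ≤ Real.pi := by
    have : |(j : ℝ)| ≤ p := by exact_mod_cast abs_le.mpr ⟨hj.1, hj.2.le⟩
    rw [abs_div, abs_mul, abs_of_pos Real.pi_pos, abs_of_pos hp, div_le_iff₀ hp, mul_comm]
    gcongr
  have hsq := one_add_cos_mul_sinPoly_sq_le (p / 2)
    (div_ne_zero (mul_ne_zero hj' Real.pi_ne_zero) hp.ne') hpi
  rw [Pi.single_eq_of_ne hj0, zero_add]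
  set S := (sinPoly (p / 2)).eval (Real.cos (j * Real.pi / p))
  calc (1 + Real.cos (j * Real.pi / p)) / 2 * |2 / p * S| ^ (r + 2)
      ≤ (1 + Real.cos (j * Real.pi / p)) / 2 * |2 / p * S| ^ 2 := by
        gcongr ?_ * ?_
        exact pow_le_pow_of_le_one (abs_nonneg _) hS (by omega)
    _ = (1 + Real.cos (j * Real.pi / p)) * S ^ 2 * (2 / p ^ 2) := by
        rw [sq_abs]
        ring
    _ ≤ Real.pi ^ 2 / (2 * (j * Real.pi / p) ^ 2) * (2 / p ^ 2) := by gcongr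
    _ = 1 / (j : ℝ) ^ 2 := by
        have := Real.pi_ne_zero
        field_simp

theorem tendsto_half_div : Tendsto (fun p : ℕ => ((p / 2 : ℕ) : ℝ) / p) atTop (𝓝 (1 / 2)) := by
  have h := (tendsto_nat_floor_mul_div_atTop (R := ℝ) one_half_pos.le).comp
    tendsto_natCast_atTop_atTop
  refine h.congr fun p => ?_
  rw [Function.comp, one_div_mul_eq_div, Nat.floor_div_ofNat, Nat.floor_natCast]

theorem tendsto_two_div_mul_sinPoly_half (x : ℝ) :
    Tendsto (fun p : ℕ => 2 / p * (sinPoly (p / 2)).eval (Real.cos (x / p))) atTop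
      (𝓝 (sinc (x / 2))) := by
  have hsmall : Tendsto (fun p : ℕ => sinc (x / p)) atTop (𝓝 1) := by
    simpa [Function.comp_def] using
      (Real.continuous_sinc.tendsto 0).comp (tendsto_const_div_atTop_nhds_zero_nat x)
  have hhalf : Tendsto (fun p : ℕ => sinc (x * (((p / 2 : ℕ) : ℝ) / p))) atTop
      (𝓝 (sinc (x / 2))) := by
    rw [← mul_one_div x]
    exact (Real.continuous_sinc.tendsto _).comp (tendsto_half_div.const_mul x)
  have h := ((tendsto_half_div.const_mul 2).mul hhalf).div hsmall one_ne_zero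
  rw [mul_one_div_cancel two_ne_zero, one_mul, div_one] at h
  refine h.congr' ?_
  filter_upwards [hsmall.eventually_ne one_ne_zero] with p hp
  rw [Pi.div_apply, div_eq_iff hp, mul_assoc _ (Polynomial.eval _ _),
    eval_sinPoly_cos_mul_sinc]
  ring_nf

theorem tendsto_scaledTerm (s : ℕ) (j : ℤ) :
    Tendsto (fun p => scaledTerm s p j) atTop (𝓝 (sinc (j * Real.pi / 2) ^ s)) := by
  have hcos : Tendsto (fun p : ℕ => (1 + Real.cos (j * Real.pi / p)) / 2) atTop (𝓝 1) := by
    have h := ((Real.continuous_cos.tendsto 0).comp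
      (tendsto_const_div_atTop_nhds_zero_nat (j * Real.pi))).const_add 1 |>.div_const 2
    rwa [Real.cos_zero, one_add_one_eq_two, div_self two_ne_zero] at h
  simpa only [one_mul, scaledTerm] using
    hcos.mul ((tendsto_two_div_mul_sinPoly_half (j * Real.pi)).pow s)

theorem tendsto_sum_scaledTerm (r : ℕ) :
    Tendsto (fun p : ℕ => ∑ j ∈ Finset.Ico (-p : ℤ) p, scaledTerm (r + 2) p j) atTop
      (𝓝 (∑' j : ℤ, sinc (j * Real.pi / 2) ^ (r + 2))) := by
  have hmem (j : ℤ) : ∀ᶠ p : ℕ in atTop, j ∈ Finset.Ico (-p : ℤ) p := by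
    filter_upwards [eventually_gt_atTop j.natAbs] with p hp
    rw [Finset.mem_Ico]
    omega
  have h := tendsto_tsum_of_dominated_convergence (𝓕 := atTop)
    (f := fun p : ℕ => (Finset.Ico (-p : ℤ) p : Set ℤ).indicator (scaledTerm (r + 2) p))
    ((hasSum_pi_single 0 1).summable.add (Real.summable_one_div_int_pow.mpr one_lt_two))
    (fun j => (tendsto_scaledTerm (r + 2) j).congr' <| by
      filter_upwards [hmem j] with p hp
      rw [Set.indicator_of_mem (Finset.mem_coe.mpr hp)])
    (Eventually.of_forall fun p j => by
      by_cases hj : j ∈ Finset.Ico (-p : ℤ) p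
      · rw [Set.indicator_of_mem (Finset.mem_coe.mpr hj)]
        exact abs_scaledTerm_le r hj
      · rw [Set.indicator_of_notMem (Finset.mem_coe.not.mpr hj), norm_zero]
        have hsingle : 0 ≤ (Pi.single 0 1 : ℤ → ℝ) := Pi.single_nonneg.mpr zero_le_one
        exact add_nonneg (hsingle j) (by positivity))
  exact h.congr fun p => by rw [← Finset.tsum_subtype', tsum_subtype]

end LimitOfTheMeans

section SecTan

theorem deriv_pi_mul_cot_pi_mul {z : ℂ} (hz : Complex.sin (Real.pi * z) ≠ 0) :
    deriv (fun x : ℂ => Real.pi * Complex.cot (Real.pi * x)) z =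
      -(Real.pi / Complex.sin (Real.pi * z)) ^ 2 := by
  have hlin : HasDerivAt (fun x : ℂ => (Real.pi : ℂ) * x) Real.pi z := by
    simpa using (hasDerivAt_id z).const_mul (Real.pi : ℂ)
  have h := ((hlin.ccos.div hlin.csin hz).const_mul (Real.pi : ℂ)).deriv
  refine h.trans ?_
  field_simp
  linear_combination -Complex.sin_sq_add_cos_sq (Real.pi * z)

theorem tsum_one_div_add_int_sq_of_im_pos {z : ℂ} (hz : 0 < z.im) :
    ∑' n : ℤ, 1 / (z + n) ^ 2 = (Real.pi / Complex.sin (Real.pi * z)) ^ 2 := by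
  have hsin : Complex.sin (Real.pi * z) ≠ 0 :=
    sin_pi_mul_ne_zero (UpperHalfPlane.coe_mem_integerComplement ⟨z, hz⟩)
  have h := iteratedDerivWithin_cot_pi_mul_eq_mul_tsum_div_pow le_rfl hz
  rw [iteratedDerivWithin_one,
    derivWithin_of_isOpen UpperHalfPlane.isOpen_upperHalfPlaneSet hz,
    deriv_pi_mul_cot_pi_mul hsin] at h
  simpa using h.symm

theorem tendsto_tsum_one_div_add_int_sq {x : ℝ} (hx : ∀ n : ℤ, (x + n : ℂ) ≠ 0) :
    Tendsto (fun y : ℝ => ∑' n : ℤ, 1 / (x + y * Complex.I + n) ^ 2) (𝓝 0)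
      (𝓝 (∑' n : ℤ, 1 / (x + n : ℂ) ^ 2)) := by
  refine tendsto_tsum_of_dominated_convergence (bound := fun n : ℤ => ‖1 / (x + n : ℂ) ^ 2‖) ?_
    (fun n => ?_) (Eventually.of_forall fun y n => ?_)
  · simpa using (EisensteinSeries.linear_right_summable x 1 le_rfl).norm
  · have hcont : Continuous fun y : ℝ => (x + y * Complex.I + n : ℂ) ^ 2 := by fun_prop
    exact tendsto_const_nhds.div (by simpa using hcont.tendsto 0) (pow_ne_zero 2 (hx n))
  · have hre : ‖(x + n : ℂ)‖ ≤ ‖(x + y * Complex.I + n : ℂ)‖ := by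
      have h := Complex.abs_re_le_norm (x + y * Complex.I + n)
      rw [← Complex.ofReal_intCast, ← Complex.ofReal_add, Complex.norm_real]
      simpa using h
    have := norm_pos_iff.mpr (hx n)
    simp only [norm_div, norm_pow]
    gcongr

theorem tsum_one_div_real_add_int_sq {x : ℝ} (hx : Real.sin (Real.pi * x) ≠ 0) :
    ∑' n : ℤ, 1 / (x + n) ^ 2 = (Real.pi / Real.sin (Real.pi * x)) ^ 2 := by
  have hne (n : ℤ) : (x + n : ℂ) ≠ 0 := by
    intro h
    obtain rfl : x = (-n : ℤ) := by
      push_cast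
      exact_mod_cast eq_neg_of_add_eq_zero_left h
    exact hx (by rw [mul_comm, Real.sin_int_mul_pi])
  have hsin : Complex.sin (Real.pi * x) ≠ 0 := by exact_mod_cast hx
  have hright : Tendsto (fun y : ℝ => (Real.pi / Complex.sin (Real.pi * (x + y * Complex.I))) ^ 2)
      (𝓝 0) (𝓝 ((Real.pi / Complex.sin (Real.pi * x)) ^ 2)) := by
    have hcont : Continuous fun y : ℝ => Complex.sin (Real.pi * (x + y * Complex.I)) := by fun_prop
    exact (tendsto_const_nhds.div (by simpa using hcont.tendsto 0) hsin).pow 2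
  have h := tendsto_nhds_unique
    ((tendsto_tsum_one_div_add_int_sq hne).mono_left nhdsWithin_le_nhds)
    ((hright.mono_left nhdsWithin_le_nhds).congr' <| by
      filter_upwards [self_mem_nhdsWithin (s := Set.Ioi (0 : ℝ))] with y hy
      exact (tsum_one_div_add_int_sq_of_im_pos (by simpa using hy)).symm)
  exact_mod_cast h

/-- The inverses of the poles `(4 n + 1) π / 2` of `sec z + tan z`. -/
noncomputable def invPole (n : ℤ) : ℝ := 2 / (Real.pi * (4 * n + 1))

theorem four_mul_add_one_ne_zero (n : ℤ) : (4 * n + 1 : ℝ) ≠ 0 := by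
  have : 4 * n + 1 ≠ 0 := by omega
  exact_mod_cast this

theorem one_sub_invPole_mul_div (n : ℤ) (z : ℝ) :
    (1 - invPole n * z) / (2 * Real.pi * invPole n) = 1 / 4 - z / (2 * Real.pi) + n := by
  have hn := four_mul_add_one_ne_zero n
  rw [invPole]
  field_simp
  ring

theorem abs_invPole_le (n : ℤ) : |invPole n| ≤ 1 / |(4 * n + 1 : ℝ)| := by
  rw [invPole, ← div_div, abs_div, abs_of_pos (by positivity : 0 < 2 / Real.pi)]
  gcongr
  exact (div_le_one Real.pi_pos).mpr Real.two_le_pi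

theorem abs_invPole_le_one (n : ℤ) : |invPole n| ≤ 1 := by
  refine (abs_invPole_le n).trans ?_
  have : (1 : ℝ) ≤ |(4 * n + 1 : ℝ)| := by
    exact_mod_cast Int.one_le_abs (by omega : 4 * n + 1 ≠ 0)
  exact (div_le_one (by positivity)).mpr this

theorem summable_invPole_sq : Summable fun n => invPole n ^ 2 := by
  have hinj : Function.Injective fun n : ℤ => 4 * n + 1 := fun m n h => by
    simp only at h
    omega
  refine Summable.of_nonneg_of_le (fun n => sq_nonneg _) (fun n => ?_)
    ((Real.summable_one_div_int_pow.mpr one_lt_two).comp_injective hinj)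
  have h := pow_le_pow_left₀ (abs_nonneg _) (abs_invPole_le n) 2
  simpa using h

theorem one_sub_sin_pos {z : ℝ} (hz : |z| < 1) : 0 < 1 - Real.sin z := by
  obtain ⟨hneg, hpos⟩ := abs_lt.mp hz
  have hpi := Real.pi_gt_three
  have hsin := Real.strictMonoOn_sin (a := z) (b := Real.pi / 2) ⟨by linarith, by linarith⟩
    ⟨by linarith, le_rfl⟩ (by linarith)
  rw [Real.sin_pi_div_two] at hsin
  linarith

theorem two_mul_sin_sq_pi_div_four_sub (z : ℝ) :
    2 * Real.sin (Real.pi / 4 - z / 2) ^ 2 = 1 - Real.sin z := by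
  have hcos : Real.cos (2 * (Real.pi / 4 - z / 2)) = Real.sin z := by
    rw [← Real.cos_pi_div_two_sub]
    ring_nf
  rw [Real.sin_sq_eq_half_sub, hcos]
  ring

theorem abs_invPole_mul_lt_one {z : ℝ} (hz : |z| < 1) (n : ℤ) : |invPole n * z| < 1 := by
  rw [abs_mul]
  exact (mul_le_of_le_one_left (abs_nonneg z) (abs_invPole_le_one n)).trans_lt hz

theorem tsum_invPole_sq_div {z : ℝ} (hz : |z| < 1) :
    ∑' n, 2 * invPole n ^ 2 / (1 - invPole n * z) ^ 2 = (1 - Real.sin z)⁻¹ := by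
  have hpi := Real.pi_ne_zero
  have hangle : Real.pi * (1 / 4 - z / (2 * Real.pi)) = Real.pi / 4 - z / 2 := by field_simp
  have hsq := two_mul_sin_sq_pi_div_four_sub z
  have hsin : Real.sin (Real.pi / 4 - z / 2) ≠ 0 := fun h => by
    rw [h] at hsq
    linarith [one_sub_sin_pos hz]
  have hterm (n : ℤ) : 2 * invPole n ^ 2 / (1 - invPole n * z) ^ 2 =
      1 / (2 * Real.pi ^ 2) * (1 / (1 / 4 - z / (2 * Real.pi) + n) ^ 2) := by
    rw [← one_sub_invPole_mul_div, div_pow, one_div_div]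
    field_simp
  simp only [hterm]
  rw [tsum_mul_left, tsum_one_div_real_add_int_sq (by rwa [hangle]), hangle, ← hsq]
  field_simp

theorem hasSum_invPole_geometric {z : ℝ} (hz : |z| < 1) (n : ℤ) :
    HasSum (fun N : ℕ => 2 * invPole n ^ (N + 2) * ((N + 1) * z ^ N))
      (2 * invPole n ^ 2 / (1 - invPole n * z) ^ 2) := by
  have hlt : ‖invPole n * z‖ < 1 := abs_invPole_mul_lt_one hz n
  have h := (hasSum_choose_mul_geometric_of_norm_lt_one 1 hlt).mul_left (2 * invPole n ^ 2)
  rw [mul_one_div] at h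
  refine h.congr_fun fun N => ?_
  rw [Nat.choose_one_right]
  push_cast
  ring

theorem abs_two_mul_invPole_pow_le (n : ℤ) (N : ℕ) :
    |2 * invPole n ^ (N + 2)| ≤ 2 * invPole n ^ 2 := by
  rw [abs_mul, abs_two, abs_pow, ← sq_abs (invPole n)]
  gcongr 2 * ?_
  exact pow_le_pow_of_le_one (abs_nonneg _) (abs_invPole_le_one n) (by omega)

theorem summable_invPole_pow (N : ℕ) : Summable fun n => 2 * invPole n ^ (N + 2) :=
  (summable_invPole_sq.mul_left 2).of_norm_bounded fun n => abs_two_mul_invPole_pow_le n N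

theorem hasSum_inv_one_sub_sin {z : ℝ} (hz : |z| < 1) :
    HasSum (fun N : ℕ => (∑' n, 2 * invPole n ^ (N + 2)) * ((N + 1) * z ^ N))
      (1 - Real.sin z)⁻¹ := by
  let a : ℤ × ℕ → ℝ := fun x => 2 * invPole x.1 ^ (x.2 + 2) * ((x.2 + 1) * z ^ x.2)
  have hsummable : Summable a := by
    have hgeom : Summable fun N : ℕ => ((N : ℝ) + 1) * |z| ^ N := by
      simpa using summable_choose_mul_geometric_of_norm_lt_one 1 (r := |z|) (by simpa using hz)
    refine ((summable_invPole_sq.mul_left 2).mul_of_nonneg hgeom (fun n => by positivity)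
      (fun N => by positivity)).of_norm_bounded fun x => ?_
    have hN : |(x.2 + 1 : ℝ)| = x.2 + 1 := abs_of_nonneg (by positivity)
    rw [Real.norm_eq_abs, abs_mul, abs_mul (x.2 + 1 : ℝ), abs_pow, hN]
    gcongr
    exact abs_two_mul_invPole_pow_le _ _
  have hrows := hsummable.hasSum.prod_fiberwise (hasSum_invPole_geometric hz)
  have hcols := ((Equiv.prodComm ℕ ℤ).hasSum_iff.mpr hsummable.hasSum).prod_fiberwise
    fun N => (summable_invPole_pow N).hasSum.mul_right ((N + 1) * z ^ N)
  rwa [← hrows.tsum_eq, tsum_invPole_sq_div hz] at hcols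

theorem deriv_sec_add_tan {z : ℝ} (hz : |z| < 1) :
    deriv (fun z => (Real.cos z)⁻¹ + Real.tan z) z = (1 - Real.sin z)⁻¹ := by
  have hpi := Real.pi_gt_three
  obtain ⟨hneg, hpos⟩ := abs_lt.mp hz
  have hcos : Real.cos z ≠ 0 := (Real.cos_pos_of_mem_Ioo ⟨by linarith, by linarith⟩).ne'
  have hsin := (one_sub_sin_pos hz).ne'
  rw [(((Real.hasDerivAt_cos z).fun_inv hcos).fun_add (Real.hasDerivAt_tan hcos)).deriv]
  field_simp
  linear_combination -Real.sin_sq_add_cos_sq z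

theorem secTanCoeff_succ (N : ℕ) : secTanCoeff (N + 1) = ∑' n, 2 * invPole n ^ (N + 2) := by
  let c : ℕ → ℝ := fun N => (∑' n, 2 * invPole n ^ (N + 2)) * (N + 1)
  have hball : ∀ᶠ z : ℝ in 𝓝 0, |z| < 1 := by
    filter_upwards [Metric.ball_mem_nhds (0 : ℝ) one_pos] with z hz
    simpa using hz
  have hseries : HasFPowerSeriesAt (deriv fun z => (Real.cos z)⁻¹ + Real.tan z)
      (FormalMultilinearSeries.ofScalars ℝ c) 0 := by
    rw [hasFPowerSeriesAt_iff]
    filter_upwards [hball] with z hz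
    rw [zero_add, deriv_sec_add_tan hz]
    refine (hasSum_inv_one_sub_sin hz).congr_fun fun N => ?_
    rw [FormalMultilinearSeries.coeff_ofScalars, smul_eq_mul]
    ring
  have h := congrArg (fun q => q.coeff N)
    (hseries.analyticAt.hasFPowerSeriesAt.eq_formalMultilinearSeries hseries)
  simp only [FormalMultilinearSeries.coeff_ofScalars, c] at h
  rw [secTanCoeff, iteratedDeriv_succ', Nat.factorial_succ]
  push_cast
  rw [mul_comm, ← div_div, div_eq_iff (by positivity), ← h]

theorem hasSum_int_even_add_odd {f : ℤ → ℝ} {a b : ℝ} (heven : HasSum (fun n => f (2 * n)) a)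
    (hodd : HasSum (fun n => f (2 * n + 1)) b) : HasSum f (a + b) := by
  have hinj := mul_right_injective₀ (two_ne_zero' ℤ)
  refine (hinj.hasSum_range_iff.mpr heven).add_isCompl ?_
    (((add_left_injective 1).comp hinj).hasSum_range_iff.mpr hodd)
  simpa [Function.comp_def] using Int.isCompl_even_odd

theorem sinc_four_mul_add_one_mul_pi_div_two (n : ℤ) :
    Real.sinc ((4 * n + 1 : ℤ) * Real.pi / 2) = invPole n := by
  have hn := four_mul_add_one_ne_zero n
  have hangle : (4 * n + 1 : ℝ) * Real.pi / 2 = Real.pi / 2 + n * (2 * Real.pi) := by ring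
  push_cast
  rw [Real.sinc_of_ne_zero (by positivity), invPole]
  nth_rw 1 [hangle]
  rw [Real.sin_add_int_mul_two_pi, Real.sin_pi_div_two, one_div_div, mul_comm Real.pi]

theorem sinc_four_mul_add_three_mul_pi_div_two (n : ℤ) :
    Real.sinc ((4 * n + 3 : ℤ) * Real.pi / 2) = invPole (-1 - n) := by
  rw [← sinc_four_mul_add_one_mul_pi_div_two, ← Real.sinc_neg]
  push_cast
  ring_nf

theorem hasSum_sinc_even_pow {s : ℕ} (hs : s ≠ 0) :
    HasSum (fun n : ℤ => Real.sinc ((2 * n : ℤ) * Real.pi / 2) ^ s) 1 := by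
  convert hasSum_single (f := fun n : ℤ => Real.sinc ((2 * n : ℤ) * Real.pi / 2) ^ s) 0 ?_ using 1
  · simp
  · intro n hn
    have hangle : ((2 * n : ℤ) : ℝ) * Real.pi / 2 = n * Real.pi := by
      push_cast
      ring
    have hne : (n * Real.pi : ℝ) ≠ 0 := mul_ne_zero (mod_cast hn) Real.pi_ne_zero
    rw [hangle, Real.sinc_of_ne_zero hne, Real.sin_int_mul_pi, zero_div, zero_pow hs]

theorem tsum_sinc_pow (r : ℕ) :
    ∑' j : ℤ, Real.sinc (j * Real.pi / 2) ^ (r + 2) = 1 + secTanCoeff (r + 1) := by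
  have hpoles := ((summable_invPole_pow r).mul_left (1 / 2)).hasSum
  rw [tsum_mul_left, ← secTanCoeff_succ] at hpoles
  simp only [one_div, inv_mul_cancel_left₀ (two_ne_zero' ℝ)] at hpoles
  have hodd : HasSum (fun n : ℤ => Real.sinc ((2 * n + 1 : ℤ) * Real.pi / 2) ^ (r + 2))
      (2⁻¹ * secTanCoeff (r + 1) + 2⁻¹ * secTanCoeff (r + 1)) := by
    refine hasSum_int_even_add_odd
      (f := fun n => Real.sinc ((2 * n + 1 : ℤ) * Real.pi / 2) ^ (r + 2))
      (hpoles.congr_fun fun n => ?_)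
      (((Equiv.subLeft (-1 : ℤ)).hasSum_iff.mpr hpoles).congr_fun fun n => ?_)
    · rw [← sinc_four_mul_add_one_mul_pi_div_two]
      ring_nf
    · rw [Function.comp_apply, Equiv.subLeft_apply, ← sinc_four_mul_add_three_mul_pi_div_two]
      ring_nf
  refine (hasSum_int_even_add_odd (f := fun j : ℤ => Real.sinc (j * Real.pi / 2) ^ (r + 2))
    (hasSum_sinc_even_pow (by omega)) hodd).tsum_eq.trans ?_
  ring

end SecTan

section Multiplicity

theorem exists_between_of_le_add_div_pow {u : ℕ → ℝ} {x C : ℝ} (hx : 2 ≤ x) (hC : 0 ≤ C)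
    (hmono : ∀ n, u n ≤ u (n + 1)) (hstep : ∀ n, u (n + 1) ≤ u n + C / x ^ n) :
    ∃ μ, ∀ n, u n ≤ μ ∧ μ ≤ u n + 2 * C / x ^ n := by
  have hx0 : 0 < x := by linarith
  have hu : Monotone u := monotone_nat_of_le_succ hmono
  have hv : Antitone fun n => u n + 2 * C / x ^ n := by
    refine antitone_nat_of_succ_le fun n => ?_
    have htail : 2 * C / x ^ (n + 1) ≤ C / x ^ n := by
      rw [pow_succ', mul_div_mul_comm]
      exact mul_le_of_le_one_left (by positivity) ((div_le_one hx0).mpr hx)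
    have hsplit : 2 * C / x ^ n = C / x ^ n + C / x ^ n := by ring
    linarith [hstep n]
  have huv (m n : ℕ) : u m ≤ u n + 2 * C / x ^ n :=
    calc u m ≤ u (max m n) := hu (le_max_left m n)
      _ ≤ u (max m n) + 2 * C / x ^ max m n := le_add_of_nonneg_right (by positivity)
      _ ≤ u n + 2 * C / x ^ n := hv (le_max_right m n)
  exact ⟨⨆ n, u n, fun n => ⟨le_ciSup ⟨_, Set.forall_mem_range.mpr fun m => huv m 0⟩ n,
    ciSup_le fun m => huv m n⟩⟩

theorem isBigO_sub_mul_pow_succ {ι : Type*} {l : Filter ι} {q u e : ι → ℝ} {A B μ : ℝ} {r : ℕ}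
    (hq : ∀ i, 0 < q i) (hle : ∀ i, u i * q i ^ (r + 1) ≤ e i)
    (hge : ∀ i, e i ≤ u i * q i ^ (r + 1) + A * q i ^ r)
    (hμ : ∀ i, u i ≤ μ ∧ μ ≤ u i + B / q i) :
    (fun i => e i - μ * q i ^ (r + 1)) =O[l] fun i => q i ^ r := by
  refine IsBigO.of_bound (max A B) (Eventually.of_forall fun i => ?_)
  have hqi := hq i
  have hlower : u i * q i ^ (r + 1) ≤ μ * q i ^ (r + 1) := by
    gcongr
    exact (hμ i).1
  have hupper : μ * q i ^ (r + 1) ≤ u i * q i ^ (r + 1) + B * q i ^ r := by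
    calc μ * q i ^ (r + 1) ≤ (u i + B / q i) * q i ^ (r + 1) := by
          gcongr
          exact (hμ i).2
      _ = u i * q i ^ (r + 1) + B * q i ^ r := by
          rw [pow_succ, add_mul]
          field_simp
  have hA : A * q i ^ r ≤ max A B * q i ^ r := by
    gcongr
    exact le_max_left A B
  have hB : B * q i ^ r ≤ max A B * q i ^ r := by
    gcongr
    exact le_max_right A B
  rw [Real.norm_eq_abs, Real.norm_of_nonneg (by positivity), abs_le]
  constructor <;> linarith [hle i, hge i]

variable {k : Type*} [Field k]

theorem le_sumDim_half_mul (p : ℕ) [Fact p.Prime] [CharP k p] (r q : ℕ) :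
    p ^ (r + 1) * sumDim k r (q / 2) ≤ sumDim k r (p * q / 2) := by
  rw [← sumDim_mul_char p]
  exact sumDim_mono r (Nat.mul_div_le_mul_div_assoc p q 2)

theorem sumDim_half_mul_le (p : ℕ) [Fact p.Prime] [CharP k p] (r q : ℕ) :
    sumDim k r (p * q / 2) ≤
      p ^ (r + 1) * sumDim k r (q / 2) + (r + 2) * p * (p * q) ^ r := by
  have hfloor : p * q / 2 = p * (q / 2) + p * (q % 2) / 2 := by
    nth_rw 1 [← Nat.div_add_mod q 2]
    rw [mul_add, mul_left_comm, Nat.mul_add_div two_pos]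
  have hrem : p * (q % 2) / 2 ≤ p := by
    have : p * (q % 2) ≤ p * 1 := Nat.mul_le_mul_left p (Nat.le_of_lt_succ (Nat.mod_lt q two_pos))
    omega
  have h := sumDim_add_le (k := k) r (p * (q / 2)) (p * (q % 2) / 2)
  rw [← hfloor, sumDim_mul_char p] at h
  refine h.trans ?_
  gcongr
  exact Nat.div_le_self _ _

/-- For `q = p ^ n` and `k = ZMod p`, the colength of `(∑ xᵢ², x₁^q, …, x_s^q)` in `s = r + 2`
variables divided by `q ^ (s - 1)`, up to an error `O(1 / q)` that comes from rounding `q / 2`. -/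
noncomputable def normalizedDim (k : Type*) [Field k] (r q : ℕ) : ℝ :=
  2 ^ (r + 2) * sumDim k r (q / 2) / (q : ℝ) ^ (r + 1)

theorem normalizedDim_mul_pow (r : ℕ) {q : ℕ} (hq : q ≠ 0) :
    normalizedDim k r q * (q : ℝ) ^ (r + 1) = 2 ^ (r + 2) * sumDim k r (q / 2) :=
  div_mul_cancel₀ _ (by positivity)

theorem normalizedDim_le_mul (p : ℕ) [hp : Fact p.Prime] [CharP k p] (r : ℕ) {q : ℕ} (hq : q ≠ 0) :
    normalizedDim k r q ≤ normalizedDim k r (p * q) := by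
  have hp0 := hp.out.pos
  have h : (p : ℝ) ^ (r + 1) * sumDim k r (q / 2) ≤ sumDim k r (p * q / 2) := by
    exact_mod_cast le_sumDim_half_mul p r q
  calc normalizedDim k r q
      = 2 ^ (r + 2) * ((p : ℝ) ^ (r + 1) * sumDim k r (q / 2)) /
          ((p * q : ℕ) : ℝ) ^ (r + 1) := by
        rw [normalizedDim]
        push_cast
        rw [mul_pow]
        field_simp
    _ ≤ normalizedDim k r (p * q) := by
        rw [normalizedDim]
        gcongr

theorem normalizedDim_mul_le (p : ℕ) [hp : Fact p.Prime] [CharP k p] (r : ℕ) {q : ℕ} (hq : q ≠ 0) :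
    normalizedDim k r (p * q) ≤ normalizedDim k r q + 2 ^ (r + 2) * (r + 2) / q := by
  have hp0 := hp.out.pos
  have h : (sumDim k r (p * q / 2) : ℝ) ≤
      (p : ℝ) ^ (r + 1) * sumDim k r (q / 2) + (r + 2) * p * (p * q) ^ r := by
    exact_mod_cast sumDim_half_mul_le p r q
  calc normalizedDim k r (p * q)
      ≤ 2 ^ (r + 2) * ((p : ℝ) ^ (r + 1) * sumDim k r (q / 2) +
          (r + 2) * p * (p * q) ^ r) / ((p * q : ℕ) : ℝ) ^ (r + 1) := by
        rw [normalizedDim]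
        gcongr
    _ = normalizedDim k r q + 2 ^ (r + 2) * (r + 2) / q := by
        rw [normalizedDim]
        push_cast
        rw [mul_pow, mul_pow]
        field_simp
        ring

theorem two_pow_mul_sumDim_succ_le (r : ℕ) {q : ℕ} (hq : q ≠ 0) :
    2 ^ (r + 2) * (sumDim k r (q / 2 + 1) : ℝ) ≤
      normalizedDim k r q * (q : ℝ) ^ (r + 1) + 2 ^ (r + 2) * (r + 2) * 2 ^ r * (q : ℝ) ^ r := by
  have hhalf : q / 2 + 1 ≤ 2 * q := by omega
  have h : (sumDim k r (q / 2 + 1) : ℝ) ≤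
      sumDim k r (q / 2) + (r + 2) * (2 * q) ^ r := by
    have h := (sumDim_add_le (k := k) r (q / 2) 1).trans
      (Nat.add_le_add_left (Nat.mul_le_mul_left _ (Nat.pow_le_pow_left hhalf r)) _)
    rw [mul_one] at h
    exact_mod_cast h
  rw [normalizedDim_mul_pow r hq]
  calc 2 ^ (r + 2) * (sumDim k r (q / 2 + 1) : ℝ)
      ≤ 2 ^ (r + 2) * (sumDim k r (q / 2) + (r + 2) * (2 * q) ^ r) := by gcongr
    _ = _ := by ring

theorem normalizedDim_self (p : ℕ) [hp : Fact p.Prime] [CharP k p] (r : ℕ) :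
    normalizedDim k r p = ∑ j ∈ Finset.Ico (-p : ℤ) p, scaledTerm (r + 2) p j := by
  rw [normalizedDim, sumDim_eq_chebMean r (Nat.div_le_self p 2),
    two_pow_mul_chebMean_div r hp.out.ne_zero]

theorem exists_isHilbertKunzMultiplicity (r p : ℕ) [hp : Fact p.Prime] :
    ∃ μ : ℝ, IsHilbertKunzMultiplicity
        (∑ i, (X i : MvPolynomial (Fin (r + 2)) (ZMod p)) ^ 2) μ ∧
      ∑ j ∈ Finset.Ico (-p : ℤ) p, scaledTerm (r + 2) p j ≤ μ ∧
      μ ≤ ∑ j ∈ Finset.Ico (-p : ℤ) p, scaledTerm (r + 2) p j +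
        2 * (2 ^ (r + 2) * (r + 2)) / p := by
  have hq (n : ℕ) : p ^ n ≠ 0 := pow_ne_zero n hp.out.ne_zero
  obtain ⟨μ, hμ⟩ := exists_between_of_le_add_div_pow
    (u := fun n => normalizedDim (ZMod p) r (p ^ n)) (x := (p : ℝ)) (C := 2 ^ (r + 2) * (r + 2))
    (mod_cast hp.out.two_le) (by positivity)
    (fun n => by simpa only [pow_succ'] using normalizedDim_le_mul p r (hq n))
    (fun n => by simpa only [pow_succ', Nat.cast_pow] using normalizedDim_mul_le p r (hq n))
  choose e hlength hle hge using exists_length_frobeniusIdeal_sum_sq (p := p) r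
  have hlower (n : ℕ) : normalizedDim (ZMod p) r (p ^ n) * ((p : ℝ) ^ n) ^ (r + 1) ≤ e n := by
    rw [← Nat.cast_pow, normalizedDim_mul_pow r (hq n)]
    exact_mod_cast hle n
  have hupper (n : ℕ) : (e n : ℝ) ≤ normalizedDim (ZMod p) r (p ^ n) * ((p : ℝ) ^ n) ^ (r + 1) +
      2 ^ (r + 2) * (r + 2) * 2 ^ r * ((p : ℝ) ^ n) ^ r := by
    rw [← Nat.cast_pow]
    exact le_trans (mod_cast hge n) (two_pow_mul_sumDim_succ_le r (hq n))
  have hbigO := isBigO_sub_mul_pow_succ (l := atTop) (fun n => pow_pos (mod_cast hp.out.pos) n)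
    hlower hupper hμ
  exact ⟨μ, ⟨e, hlength, hbigO⟩, by simpa [← normalizedDim_self (k := ZMod p) p r] using hμ 1⟩

end Multiplicity

theorem theorem3p8 (s : ℕ) (hs : 2 ≤ s) :
    ∃ μ : ℕ → ℝ,
      (∀ p : ℕ, p.Prime →
        IsHilbertKunzMultiplicity (∑ i : Fin s, (X i : MvPolynomial (Fin s) (ZMod p)) ^ 2) (μ p)) ∧
      Tendsto μ (atTop ⊓ 𝓟 {p : ℕ | p.Prime}) (𝓝 (1 + secTanCoeff (s - 1))) := by
  obtain ⟨r, rfl⟩ := Nat.exists_eq_add_of_le' hs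
  choose! μ hmult hlower hupper using fun (p : ℕ) (hp : p.Prime) =>
    have : Fact p.Prime := ⟨hp⟩
    exists_isHilbertKunzMultiplicity r p
  have hprime : ∀ᶠ p in atTop ⊓ 𝓟 {p : ℕ | p.Prime}, p.Prime :=
    mem_inf_of_right (mem_principal_self _)
  have hsum : Tendsto (fun p : ℕ => ∑ j ∈ Finset.Ico (-p : ℤ) p, scaledTerm (r + 2) p j)
      (atTop ⊓ 𝓟 {p : ℕ | p.Prime}) (𝓝 (1 + secTanCoeff (r + 2 - 1))) :=
    (tsum_sinc_pow r ▸ tendsto_sum_scaledTerm r).mono_left inf_le_left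
  have herror : Tendsto (fun p : ℕ => 2 * (2 ^ (r + 2) * ((r : ℝ) + 2)) / p)
      (atTop ⊓ 𝓟 {p : ℕ | p.Prime}) (𝓝 0) :=
    (tendsto_const_div_atTop_nhds_zero_nat _).mono_left inf_le_left
  exact ⟨μ, hmult, tendsto_of_tendsto_of_tendsto_of_le_of_le' hsum
    (by simpa using hsum.add herror) (hprime.mono hlower) (hprime.mono hupper)⟩
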